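/- For a $k\times n$ integer matrix $M$ let $\operatorname{intcol}(M)\subseteq\mathbb Z^k$ be the set of integer linear combinations of its columns, and let the size of $M$ be $k+n+\sum_{i,j}(1+\operatorname{len}(M_{ij}))$, where $\operatorname{len}(z)$ is the length of the binary expansion of $|z|$. There are an algorithm and a polynomial $p$ such that the following holds for every finite Abelian group $G$, every $k,n\ge 0$, all $a_1,\dots,a_k\in G$ that generate $G$, and every $M\in\mathbb Z^{k\times n}$ such that for all $\mathbf x=(x_1,\dots,x_k)^T\in\mathbb Z^k$ $$a_1^{x_1}\cdots a_k^{x_k}=e\iff \mathbf x\in\operatorname{intcol}(M).$$ Given $M$ and $a_1,\dots,a_k$, the algorithm computes, in time at most $p(\text{size of }M)$, elements $g_1,\dots,g_l\in G$ with $l\le k$ such that $G$ is the internal direct sum $$G=\langle g_1\rangle\oplus\cdots\oplus\langle g_l\rangle .$$ Here an algorithm is a program, independent of $G$, for a random access machine with logarithmic cost: operations on integers are charged by the binary lengths of the integers involved (binary integer operations by the product of one plus the binary lengths of the operands). Elements of $G$ are accessible only as a black box, through multiplication and inversion, each of which costs one unit, and the identity element. -/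

import Mathlib

/-! ### The integer column span and the size of an integer matrix -/

/-- The set of integer linear combinations of the columns of `M`. -/
def intcol {k n : ℕ} (M : Matrix (Fin k) (Fin n) ℤ) : Submodule ℤ (Fin k → ℤ) :=
  Submodule.span ℤ (Set.range M.col)

/-- The length of the binary expansion of `|z|`. -/
def bitSize (z : ℤ) : ℕ := Nat.size z.natAbs

/-- The size of an integer matrix: one unit for each row, each column and each entry (for its
sign), plus the binary lengths of all the entries. -/
def matrixSize {k n : ℕ} (M : Matrix (Fin k) (Fin n) ℤ) : ℕ :=
  k + n + ∑ i, ∑ j, (1 + bitSize (M i j))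

/-! ### A random access machine with logarithmic cost and black-box access to a group

A program works on integer variables, integer arrays (with two indices) and arrays of group
elements (with one index).  It has integer arithmetic, comparisons and indirect addressing, where
every operation is charged by the binary lengths of the integers involved (integer operations
at the schoolbook rate, the product of the lengths of the operands), and the group operations,
each of which costs one unit.  Group elements cannot be compared or inspected.  Program texts are
finite and do not depend on the group. -/

namespace GroupRAM

/-- Binary operations on integers. -/
inductive Op
  | add | sub | mul | div | mod | eq | lt

/-- Quotient and remainder are those of Euclidean division; comparisons return `0` or `1`. -/
def Op.eval : Op → ℤ → ℤ → ℤ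
  | add, x, y => x + y
  | sub, x, y => x - y
  | mul, x, y => x * y
  | div, x, y => x / y
  | mod, x, y => x % y
  | eq, x, y => if x = y then 1 else 0
  | lt, x, y => if x < y then 1 else 0

/-- Integer expressions: literals, variables, array cells, binary operations. -/
inductive Expr
  | lit (c : ℤ)
  | var (x : ℕ)
  | cell (A : ℕ) (i j : Expr)
  | bin (o : Op) (e₁ e₂ : Expr)

/-- Group expressions: the identity, array cells, products, inverses. -/
inductive GExpr
  | one
  | cell (B : ℕ) (i : Expr)
  | mul (u v : GExpr)
  | inv (u : GExpr)

/-- Programs. -/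
inductive Cmd
  | skip
  | assign (x : ℕ) (e : Expr)
  | store (A : ℕ) (i j e : Expr)
  | gstore (B : ℕ) (i : Expr) (u : GExpr)
  | seq (P Q : Cmd)
  | cond (e : Expr) (P Q : Cmd)
  | loop (e : Expr) (P : Cmd)

/-- The content of the memory. -/
structure State (G : Type*) where
  /-- the integer variables -/
  var : ℕ → ℤ
  /-- the integer arrays: name, first index, second index -/
  arr : ℕ → ℤ → ℤ → ℤ
  /-- the arrays of group elements: name, index -/
  grp : ℕ → ℤ → G

section Semantics

variable {G : Type*}

/-- Write `v` into the variable `x`. -/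
def State.setVar (s : State G) (x : ℕ) (v : ℤ) : State G :=
  { s with var := fun y => if y = x then v else s.var y }

/-- Write `v` into cell `(i, j)` of the integer array `A`. -/
def State.setArr (s : State G) (A : ℕ) (i j v : ℤ) : State G :=
  { s with arr := fun A' i' j' => if A' = A ∧ i' = i ∧ j' = j then v else s.arr A' i' j' }

/-- Write `g` into cell `i` of the group array `B`. -/
def State.setGrp (s : State G) (B : ℕ) (i : ℤ) (g : G) : State G :=
  { s with grp := fun B' i' => if B' = B ∧ i' = i then g else s.grp B' i' }

/-- The value of an integer expression. -/
def Expr.eval (s : State G) : Expr → ℤ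
  | lit c => c
  | var x => s.var x
  | cell A i j => s.arr A (i.eval s) (j.eval s)
  | bin o e₁ e₂ => o.eval (e₁.eval s) (e₂.eval s)

/-- The cost of evaluating an integer expression. -/
def Expr.cost (s : State G) : Expr → ℕ
  | lit c => 1 + bitSize c
  | var x => 1 + bitSize (s.var x)
  | cell A i j => i.cost s + j.cost s + 1 + bitSize (i.eval s) + bitSize (j.eval s) +
      bitSize (s.arr A (i.eval s) (j.eval s))
  | bin _ e₁ e₂ => e₁.cost s + e₂.cost s +
      (1 + bitSize (e₁.eval s)) * (1 + bitSize (e₂.eval s))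

/-- The value of a group expression. -/
def GExpr.eval [Group G] (s : State G) : GExpr → G
  | one => 1
  | cell B i => s.grp B (i.eval s)
  | mul u v => u.eval s * v.eval s
  | inv u => (u.eval s)⁻¹

/-- The cost of evaluating a group expression. -/
def GExpr.cost (s : State G) : GExpr → ℕ
  | one => 1
  | cell _ i => i.cost s + 1 + bitSize (i.eval s)
  | mul u v => u.cost s + v.cost s + 1
  | inv u => u.cost s + 1

/-- `Runs P s s' t`: started in the memory content `s`, the program `P` halts with the memory
content `s'` after a computation of cost exactly `t`.  In `cond` and `loop` a value counts as
true if it is not zero. -/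
inductive Runs [Group G] : Cmd → State G → State G → ℕ → Prop
  | skip (s : State G) : Runs Cmd.skip s s 1
  | assign (s : State G) (x : ℕ) (e : Expr) :
      Runs (Cmd.assign x e) s (s.setVar x (e.eval s)) (e.cost s + 1 + bitSize (e.eval s))
  | store (s : State G) (A : ℕ) (i j e : Expr) :
      Runs (Cmd.store A i j e) s (s.setArr A (i.eval s) (j.eval s) (e.eval s))
        (i.cost s + j.cost s + e.cost s + 1 + bitSize (i.eval s) + bitSize (j.eval s) +
          bitSize (e.eval s))
  | gstore (s : State G) (B : ℕ) (i : Expr) (u : GExpr) :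
      Runs (Cmd.gstore B i u) s (s.setGrp B (i.eval s) (u.eval s))
        (i.cost s + u.cost s + 1 + bitSize (i.eval s))
  | seq {P Q : Cmd} {s s' s'' : State G} {t t' : ℕ} (hP : Runs P s s' t) (hQ : Runs Q s' s'' t') :
      Runs (Cmd.seq P Q) s s'' (t + t')
  | cond_true {e : Expr} {P : Cmd} (Q : Cmd) {s s' : State G} {t : ℕ} (he : e.eval s ≠ 0)
      (hP : Runs P s s' t) : Runs (Cmd.cond e P Q) s s' (e.cost s + 1 + t)
  | cond_false {e : Expr} (P : Cmd) {Q : Cmd} {s s' : State G} {t : ℕ} (he : e.eval s = 0)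
      (hQ : Runs Q s s' t) : Runs (Cmd.cond e P Q) s s' (e.cost s + 1 + t)
  | loop_true {e : Expr} {P : Cmd} {s s' s'' : State G} {t t' : ℕ} (he : e.eval s ≠ 0)
      (hP : Runs P s s' t) (hL : Runs (Cmd.loop e P) s' s'' t') :
      Runs (Cmd.loop e P) s s'' (e.cost s + 1 + t + t')
  | loop_false {e : Expr} (P : Cmd) {s : State G} (he : e.eval s = 0) :
      Runs (Cmd.loop e P) s s (e.cost s + 1)

/-- The memory at the start, for input `M` and `a`: variables `0` and `1` hold the numbers of rows
and of columns of `M`, integer array `0` holds `M`, group array `0` holds the elements `a i`;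
all other variables and cells hold `0`, respectively the identity.  Indices start at `0`. -/
def inputState [Group G] {k n : ℕ} (M : Matrix (Fin k) (Fin n) ℤ) (a : Fin k → G) : State G where
  var x := if x = 0 then (k : ℤ) else if x = 1 then (n : ℤ) else 0
  arr A i j :=
    if h : A = 0 ∧ (0 ≤ i ∧ i < k) ∧ (0 ≤ j ∧ j < n) then
      M ⟨i.toNat, by omega⟩ ⟨j.toNat, by omega⟩
    else 0
  grp B i := if h : B = 0 ∧ 0 ≤ i ∧ i < k then a ⟨i.toNat, by omega⟩ else 1

/-- The output format: variable `0` holds the length `l` of the list `g`, and the cells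
`0, …, l - 1` of group array `0` hold its members. -/
def State.Outputs (s : State G) {l : ℕ} (g : Fin l → G) : Prop :=
  s.var 0 = l ∧ ∀ i : Fin l, s.grp 0 (i : ℕ) = g i

end Semantics

end GroupRAM

theorem bitSize_le_iff {z : ℤ} {b : ℕ} : bitSize z ≤ b ↔ |z| < 2 ^ b := by
  rw [bitSize, Nat.size_le, Int.abs_eq_natAbs]
  exact_mod_cast Iff.rfl

theorem abs_lt_two_pow_bitSize (z : ℤ) : |z| < 2 ^ bitSize z := bitSize_le_iff.1 le_rfl

namespace GroupRAM

theorem Op.bitSize_eval_le (o : Op) (x y : ℤ) :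
    bitSize (o.eval x y) ≤ bitSize x + bitSize y + 1 := by
  have hx := abs_lt_two_pow_bitSize x
  have hy := abs_lt_two_pow_bitSize y
  have h1 : (1 : ℤ) ≤ 2 ^ bitSize x := one_le_pow₀ (by norm_num)
  have h2 : (1 : ℤ) ≤ 2 ^ bitSize y := one_le_pow₀ (by norm_num)
  have hsum : |x| + |y| < 2 ^ (bitSize x + bitSize y + 1) := by
    rw [pow_succ, pow_add]; nlinarith
  have hone : (1 : ℤ) < 2 ^ (bitSize x + bitSize y + 1) := by
    rw [pow_succ, pow_add]; nlinarith
  rw [bitSize_le_iff]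
  cases o with
  | add => exact (abs_add_le x y).trans_lt hsum
  | sub => exact (abs_sub x y).trans_lt hsum
  | mul =>
    simp only [Op.eval, abs_mul]
    rw [pow_succ, pow_add]
    have := mul_lt_mul'' hx hy (abs_nonneg _) (abs_nonneg _)
    nlinarith
  | div =>
    refine lt_of_le_of_lt ?_ hsum
    have : |x / y| ≤ |x| := Int.abs_ediv_le_abs x y
    exact this.trans (le_add_of_nonneg_right (abs_nonneg _))
  | mod =>
    refine lt_of_le_of_lt ?_ hsum
    simp only [Op.eval]
    rcases eq_or_ne y 0 with rfl | h
    · simp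
    · rw [abs_of_nonneg (Int.emod_nonneg x h)]
      exact (Int.emod_lt_abs x h).le.trans (le_add_of_nonneg_left (abs_nonneg _))
  | eq => simp only [Op.eval]; split_ifs <;> simp [hone]
  | lt => simp only [Op.eval]; split_ifs <;> simp [hone]

/-- The number of nodes of an expression, literals counted with their lengths. -/
def Expr.weight : Expr → ℕ
  | .lit c => 1 + bitSize c
  | .var _ => 1
  | .cell _ i j => i.weight + j.weight + 1
  | .bin _ e₁ e₂ => e₁.weight + e₂.weight + 1

/-- The number of nodes of a group expression. -/
def GExpr.weight : GExpr → ℕ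
  | .one => 1
  | .cell _ i => i.weight + 1
  | .mul u v => u.weight + v.weight + 1
  | .inv u => u.weight + 1

variable {G : Type*}

/-- All integers in the memory have at most `b` binary digits. -/
structure State.Bounded (b : ℕ) (s : State G) : Prop where
  var : ∀ x, |s.var x| < 2 ^ b
  arr : ∀ A i j, |s.arr A i j| < 2 ^ b

theorem Expr.bitSize_eval_le {b : ℕ} {s : State G} (hs : s.Bounded b) (e : Expr) :
    bitSize (e.eval s) ≤ e.weight * (b + 1) := by
  induction e with
  | lit c => simp only [eval, weight]; nlinarith
  | var x => have := bitSize_le_iff.2 (hs.var x); simp only [eval, weight]; omega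
  | cell A i j =>
    have := bitSize_le_iff.2 (hs.arr A (i.eval s) (j.eval s))
    simp only [eval, weight]; nlinarith
  | bin o e₁ e₂ h₁ h₂ =>
    have := o.bitSize_eval_le (e₁.eval s) (e₂.eval s)
    simp only [eval, weight]; nlinarith

theorem Expr.cost_le {b w : ℕ} {s : State G} (hs : s.Bounded b) (e : Expr) (hw : e.weight ≤ w) :
    e.cost s ≤ e.weight * (1 + w * (b + 1)) ^ 2 := by
  have key : ∀ e : Expr, e.weight ≤ w → bitSize (e.eval s) ≤ w * (b + 1) := fun e he =>
    (e.bitSize_eval_le hs).trans (Nat.mul_le_mul_right _ he)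
  induction e with
  | lit c =>
    simp only [cost, weight]
    exact Nat.le_mul_of_pos_right _ (by positivity)
  | var x =>
    have := key _ hw
    simp only [cost, weight, eval] at *
    nlinarith [sq_nonneg (w * (b + 1))]
  | cell A i j hi hj =>
    simp only [weight] at hw
    have h1 := key i (by omega)
    have h2 := key j (by omega)
    have h3 := bitSize_le_iff.2 (hs.arr A (i.eval s) (j.eval s))
    have h4 := hi (by omega)
    have h5 := hj (by omega)
    have h6 : b + 1 ≤ (w * (b + 1)) ^ 2 := by
      have : 1 * (b + 1) ≤ w * (b + 1) := Nat.mul_le_mul_right _ (by omega)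
      nlinarith
    simp only [cost, weight]
    nlinarith
  | bin o e₁ e₂ hi hj =>
    simp only [weight] at hw
    have h1 := key e₁ (by omega)
    have h2 := key e₂ (by omega)
    have h4 := hi (by omega)
    have h5 := hj (by omega)
    have h6 : (1 + bitSize (e₁.eval s)) * (1 + bitSize (e₂.eval s)) ≤
      (1 + w * (b + 1)) ^ 2 := by
      rw [sq]; exact Nat.mul_le_mul (by omega) (by omega)
    simp only [cost, weight]
    nlinarith

theorem GExpr.cost_le {b w : ℕ} {s : State G} (hs : s.Bounded b) (u : GExpr)
    (hw : u.weight ≤ w) : u.cost s ≤ u.weight * (1 + w * (b + 1)) ^ 2 := by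
  have h1 : 1 ≤ (1 + w * (b + 1)) ^ 2 := Nat.one_le_pow _ _ (by omega)
  induction u with
  | one => simpa [cost, weight] using h1
  | cell B i =>
    simp only [weight] at hw
    have h2 := i.cost_le hs (w := w) (by omega)
    have h3 := (i.bitSize_eval_le hs).trans (Nat.mul_le_mul_right (b + 1) (by omega : i.weight ≤ w))
    simp only [cost, weight]
    nlinarith
  | mul u v hu hv =>
    simp only [weight] at hw
    have := hu (by omega)
    have := hv (by omega)
    simp only [cost, weight]
    nlinarith
  | inv u hu =>
    simp only [weight] at hw
    have := hu (by omega)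
    simp only [cost, weight]
    nlinarith

/-- A bound for the cost of a single step of a program with expressions of weight at most `128`
in a memory with integers of at most `b` binary digits. -/
def stepCost (b : ℕ) : ℕ := 512 * (1 + 128 * (b + 1)) ^ 2

theorem bitSize_eval_le_of_weight {b : ℕ} {s : State G} (hs : s.Bounded b) {e : Expr}
    (hw : e.weight ≤ 128) : 1 + bitSize (e.eval s) ≤ (1 + 128 * (b + 1)) ^ 2 := by
  have := (e.bitSize_eval_le hs).trans (Nat.mul_le_mul_right (b + 1) hw)
  nlinarith

theorem cost_le_of_weight {b : ℕ} {s : State G} (hs : s.Bounded b) {e : Expr}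
    (hw : e.weight ≤ 128) : e.cost s ≤ 128 * (1 + 128 * (b + 1)) ^ 2 :=
  (e.cost_le hs hw).trans (Nat.mul_le_mul_right _ hw)

/-- The memory contents `s` and `s'` agree outside of the variables `X`, the integer arrays `A`
and the group arrays `B`. -/
structure State.Agree (X A B : List ℕ) (s s' : State G) : Prop where
  var : ∀ x, x ∉ X → s'.var x = s.var x
  arr : ∀ a, a ∉ A → s'.arr a = s.arr a
  grp : ∀ c, c ∉ B → s'.grp c = s.grp c

namespace State.Agree

variable {X A B X' A' B' : List ℕ} {s s' s'' : State G}

theorem refl (s : State G) : s.Agree X A B s := ⟨fun _ _ => rfl, fun _ _ => rfl, fun _ _ => rfl⟩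

theorem trans (h : s.Agree X A B s') (h' : s'.Agree X' A' B' s'') (hX : X' ⊆ X) (hA : A' ⊆ A)
    (hB : B' ⊆ B) : s.Agree X A B s'' :=
  ⟨fun x hx => (h'.var x fun h => hx (hX h)).trans (h.var x hx),
    fun x hx => (h'.arr x fun h => hx (hA h)).trans (h.arr x hx),
    fun x hx => (h'.grp x fun h => hx (hB h)).trans (h.grp x hx)⟩

theorem setVar (h : s.Agree X A B s') {x : ℕ} (hx : x ∈ X) (v : ℤ) :
    s.Agree X A B (s'.setVar x v) :=
  ⟨fun y hy => by
    rw [← h.var y hy]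
    simp only [State.setVar]
    exact if_neg fun h : y = x => hy (h ▸ hx), h.arr, h.grp⟩

theorem setArr (h : s.Agree X A B s') {a : ℕ} (ha : a ∈ A) (i j v : ℤ) :
    s.Agree X A B (s'.setArr a i j v) :=
  ⟨h.var, fun c hc => by
    rw [← h.arr c hc]
    funext i' j'
    exact if_neg fun h : c = a ∧ _ => hc (h.1 ▸ ha), h.grp⟩

theorem setGrp (h : s.Agree X A B s') {a : ℕ} (ha : a ∈ B) (i : ℤ) (g : G) :
    s.Agree X A B (s'.setGrp a i g) :=
  ⟨h.var, h.arr, fun c hc => by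
    rw [← h.grp c hc]
    funext i'
    exact if_neg fun h : c = a ∧ _ => hc (h.1 ▸ ha)⟩

end State.Agree

variable [Group G]

/-- Started in the memory `s`, provided all its integers have at most `b` digits, the program `P`
halts after at most `m` steps, no integer of more than `b` digits is ever stored, and `Q` holds at
the end. -/
def Halts (b : ℕ) (P : Cmd) (m : ℕ) (Q : State G → Prop) (s : State G) : Prop :=
  s.Bounded b → ∃ s' t, Runs P s s' t ∧ t ≤ m * stepCost b ∧ s'.Bounded b ∧ Q s'

namespace Halts

variable {b m m' : ℕ} {P P' : Cmd} {Q Q' : State G → Prop} {s : State G}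

theorem mono (h : Halts b P m Q s) (hm : m ≤ m') (hQ : ∀ s', s'.Bounded b → Q s' → Q' s') :
    Halts b P m' Q' s := fun hs => by
  obtain ⟨s', t, h1, h2, h3, h4⟩ := h hs
  exact ⟨s', t, h1, h2.trans (Nat.mul_le_mul_right _ hm), h3, hQ _ h3 h4⟩

theorem imp (h : Halts b P m Q s) (hQ : ∀ s', Q s' → Q' s') : Halts b P m Q' s :=
  h.mono le_rfl fun s' _ => hQ s'

theorem of_bounded (h : s.Bounded b → Halts b P m Q s) : Halts b P m Q s := fun hs => h hs hs

theorem skip (h : Q s) : Halts b Cmd.skip 1 Q s := fun hs =>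
  ⟨s, 1, .skip s, by
    have h1 : 1 ≤ (1 + 128 * (b + 1)) ^ 2 := Nat.one_le_pow _ _ (by omega)
    simp only [stepCost]; omega, hs, h⟩

theorem assign {x : ℕ} {e : Expr} (hw : e.weight ≤ 128) (he : |e.eval s| < 2 ^ b)
    (h : Q (s.setVar x (e.eval s))) : Halts b (.assign x e) 1 Q s := fun hs => by
  refine ⟨_, _, .assign s x e, ?_, ⟨fun y => ?_, hs.arr⟩, h⟩
  · have h1 := cost_le_of_weight hs hw
    have h2 := bitSize_eval_le_of_weight hs hw
    simp only [stepCost]; omega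
  · simp only [State.setVar]
    split_ifs
    exacts [he, hs.var y]

theorem store {A : ℕ} {i j e : Expr} (hi : i.weight ≤ 128) (hj : j.weight ≤ 128)
    (hw : e.weight ≤ 128) (he : |e.eval s| < 2 ^ b)
    (h : Q (s.setArr A (i.eval s) (j.eval s) (e.eval s))) :
    Halts b (.store A i j e) 1 Q s := fun hs => by
  refine ⟨_, _, .store s A i j e, ?_, ⟨hs.var, fun A' i' j' => ?_⟩, h⟩
  · have h1 := cost_le_of_weight hs hw
    have h2 := bitSize_eval_le_of_weight hs hw
    have h3 := cost_le_of_weight hs hi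
    have h4 := bitSize_eval_le_of_weight hs hi
    have h5 := cost_le_of_weight hs hj
    have h6 := bitSize_eval_le_of_weight hs hj
    simp only [stepCost]; omega
  · simp only [State.setArr]
    split_ifs
    exacts [he, hs.arr _ _ _]

theorem gstore {B : ℕ} {i : Expr} {u : GExpr} (hi : i.weight ≤ 128) (hw : u.weight ≤ 128)
    (h : Q (s.setGrp B (i.eval s) (u.eval s))) : Halts b (.gstore B i u) 1 Q s := fun hs => by
  refine ⟨_, _, .gstore s B i u, ?_, ⟨hs.var, hs.arr⟩, h⟩
  have h1 := (u.cost_le hs hw).trans (Nat.mul_le_mul_right _ hw)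
  have h3 := cost_le_of_weight hs hi
  have h4 := bitSize_eval_le_of_weight hs hi
  simp only [stepCost]; omega

theorem seq (h : Halts b P m (Halts b P' m' Q) s) : Halts b (.seq P P') (m + m') Q s :=
    fun hs => by
  obtain ⟨s', t, h1, h2, h3, h4⟩ := h hs
  obtain ⟨s'', t', h1', h2', h3', h4'⟩ := h4 h3
  exact ⟨s'', t + t', .seq h1 h1', by rw [add_mul]; omega, h3', h4'⟩

theorem cond {e : Expr} (hw : e.weight ≤ 128) (h : e.eval s ≠ 0 → Halts b P m Q s)
    (h' : e.eval s = 0 → Halts b P' m Q s) : Halts b (.cond e P P') (m + 1) Q s := fun hs => by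
  have hc := cost_le_of_weight hs hw
  have h1 : 1 ≤ (1 + 128 * (b + 1)) ^ 2 := Nat.one_le_pow _ _ (by omega)
  by_cases he : e.eval s = 0
  · obtain ⟨s', t, h1, h2, h3, h4⟩ := h' he hs
    refine ⟨s', _, .cond_false P he h1, ?_, h3, h4⟩
    rw [add_mul]; simp only [stepCost] at *; omega
  · obtain ⟨s', t, h1, h2, h3, h4⟩ := h he hs
    refine ⟨s', _, .cond_true P' he h1, ?_, h3, h4⟩
    rw [add_mul]; simp only [stepCost] at *; omega

theorem loop {e : Expr} (hw : e.weight ≤ 128) (I : ℕ → State G → Prop)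
    (h0 : ∀ r s, I r s → e.eval s = 0 → Q s)
    (h1 : ∀ r s, I r s → e.eval s ≠ 0 → ∃ r', r = r' + 1 ∧ Halts b P m (I r') s) :
    ∀ r s, I r s → Halts b (.loop e P) (r * (m + 1) + 1) Q s := by
  intro r
  induction r with
  | zero =>
    intro s hI hs
    have hc := cost_le_of_weight hs hw
    have h1' : 1 ≤ (1 + 128 * (b + 1)) ^ 2 := Nat.one_le_pow _ _ (by omega)
    have he : e.eval s = 0 := by
      by_contra he
      obtain ⟨r', hr, -⟩ := h1 _ _ hI he
      omega
    refine ⟨s, _, .loop_false P he, ?_, hs, h0 _ _ hI he⟩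
    simp only [stepCost]; omega
  | succ r ih =>
    intro s hI hs
    have hc := cost_le_of_weight hs hw
    have h1' : 1 ≤ (1 + 128 * (b + 1)) ^ 2 := Nat.one_le_pow _ _ (by omega)
    by_cases he : e.eval s = 0
    · refine ⟨s, _, .loop_false P he, ?_, hs, h0 _ _ hI he⟩
      have : stepCost b ≤ ((r + 1) * (m + 1) + 1) * stepCost b :=
        Nat.le_mul_of_pos_left _ (by omega)
      refine le_trans ?_ this
      simp only [stepCost]; omega
    · obtain ⟨r', hr, hP⟩ := h1 _ _ hI he
      obtain rfl : r = r' := by omega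
      obtain ⟨s', t, h2, h3, h4, h5⟩ := hP hs
      obtain ⟨s'', t', h6, h7, h8, h9⟩ := ih s' h5 h4
      refine ⟨s'', _, .loop_true he h2 h6, ?_, h8, h9⟩
      have : ((r + 1) * (m + 1) + 1) * stepCost b =
        stepCost b + m * stepCost b + (r * (m + 1) + 1) * stepCost b := by ring
      rw [this]
      have : e.cost s + 1 ≤ stepCost b := by simp only [stepCost]; omega
      omega

end Halts

/-- `for x = lo, …, hi - 1 do P` -/
def forLoop (x : ℕ) (lo hi : Expr) (P : Cmd) : Cmd :=
  .seq (.assign x lo) (.loop (.bin .lt (.var x) hi)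
    (.seq P (.assign x (.bin .add (.var x) (.lit 1)))))

theorem Halts.forLoop {b m N : ℕ} {x : ℕ} {lo hi : Expr} {P : Cmd} {Q : State G → Prop}
    {s : State G} (I : ℤ → State G → Prop) {u v : ℤ} (huv : u ≤ v) (hu : 0 ≤ u) (hv : v < 2 ^ b)
    (hN : v - u ≤ N) (hwlo : lo.weight ≤ 128) (hwhi : hi.weight ≤ 100)
    (hlo : lo.eval s = u) (hhi : ∀ i s', I i s' → hi.eval s' = v)
    (hx : ∀ i s' z, I i s' → I i (s'.setVar x z)) (h0 : I u s)
    (hstep : ∀ i s', u ≤ i → i < v → I i s' → s'.var x = i →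
      Halts b P m (fun s'' => I (i + 1) s'' ∧ s''.var x = i) s')
    (hQ : ∀ s', I v s' → Q s') :
    Halts b (GroupRAM.forLoop x lo hi P) (N * (m + 2) + 2) Q s := by
  have hone : bitSize 1 = 1 := by decide
  have hb : Halts b (GroupRAM.forLoop x lo hi P) (1 + (N * (m + 1 + 1) + 1)) Q s := by
    refine .seq (.assign hwlo (by rw [hlo, abs_of_nonneg hu]; omega) ?_)
    rw [hlo]
    refine Halts.loop (by simp only [Expr.weight]; omega)
      (fun r s' => I (s'.var x) s' ∧ u ≤ s'.var x ∧ s'.var x ≤ v ∧ v - s'.var x ≤ r) ?_ ?_ N _ ?_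
    · rintro r s' ⟨h1, h2, h3, -⟩ he
      simp only [Expr.eval, Op.eval, hhi _ _ h1] at he
      have : s'.var x = v := by
        split_ifs at he
        · exact absurd he one_ne_zero
        · omega
      exact hQ _ (this ▸ h1)
    · rintro r s' ⟨h1, h2, h3, h4⟩ he
      simp only [Expr.eval, Op.eval, hhi _ _ h1] at he
      have h5 : s'.var x < v := by
        by_contra h; simp [h] at he
      refine ⟨r - 1, by omega, .seq ((hstep _ s' h2 h5 h1 rfl).imp ?_)⟩
      rintro s'' ⟨h6, h7⟩
      refine .assign (by simp only [Expr.weight, hone]; omega) ?_ ?_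
      · simp only [Expr.eval, Op.eval, h7]
        rw [abs_of_nonneg (by omega)]; omega
      · simp only [Expr.eval, Op.eval, h7]
        have h8 : (s''.setVar x (s'.var x + 1)).var x = s'.var x + 1 := by simp [State.setVar]
        rw [h8]
        exact ⟨hx _ _ _ h6, by omega, by omega, by omega⟩
    · have h8 : (s.setVar x u).var x = u := by simp [State.setVar]
      rw [h8]
      exact ⟨hx _ _ _ h0, le_rfl, huv, hN⟩
  exact hb.mono (by nlinarith) fun _ _ h => h

end GroupRAM

/-! ### Division with the nearest remainder -/

/-- A quotient such that the remainder `x - p * nearQuot x p` is at most `|p| / 2` in absolute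
value, unless `p = 0`. -/
def nearQuot (x p : ℤ) : ℤ := (2 * x * p + p * p) / (2 * (p * p))

theorem nearQuot_zero_left (p : ℤ) : nearQuot 0 p = 0 := by
  rw [nearQuot]
  rcases eq_or_ne p 0 with rfl | h
  · simp
  · have : 0 < p * p := mul_self_pos.2 h
    exact Int.ediv_eq_zero_of_lt (by nlinarith) (by nlinarith)

theorem two_mul_abs_sub_mul_nearQuot_le (x : ℤ) {p : ℤ} (hp : p ≠ 0) :
    2 * |x - p * nearQuot x p| ≤ |p| := by
  have h0 : 0 < p * p := mul_self_pos.2 hp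
  have h1 := Int.emod_add_mul_ediv (2 * x * p + p * p) (2 * (p * p))
  have h2 := Int.emod_nonneg (2 * x * p + p * p) (by positivity : 2 * (p * p) ≠ 0)
  have h3 := Int.emod_lt_of_pos (2 * x * p + p * p) (by positivity : 0 < 2 * (p * p))
  change _ + 2 * (p * p) * nearQuot x p = _ at h1
  set r := (2 * x * p + p * p) % (2 * (p * p))
  set y := x - p * nearQuot x p with hy
  have h4 : 2 * p * y = r - p * p := by rw [hy]; linear_combination -h1
  have h5 : |2 * p * y| ≤ |p * p| := by
    rw [h4, abs_of_pos h0, abs_le]; constructor <;> linarith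
  have h6 : 0 < |p| := abs_pos.2 hp
  rw [abs_mul, abs_mul, abs_mul, abs_two] at h5
  nlinarith

/-- The remainder modulo `D` of least absolute value. -/
def nearMod (D x : ℤ) : ℤ := x - D * nearQuot x D

@[simp] theorem nearMod_zero (D : ℤ) : nearMod D 0 = 0 := by simp [nearMod, nearQuot_zero_left]

theorem two_mul_abs_nearMod_le {D : ℤ} (hD : D ≠ 0) (x : ℤ) : 2 * |nearMod D x| ≤ |D| :=
  two_mul_abs_sub_mul_nearQuot_le x hD

theorem dvd_sub_nearMod (D x : ℤ) : D ∣ x - nearMod D x := ⟨nearQuot x D, by rw [nearMod]; ring⟩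

theorem abs_nearMod_le {D x z : ℤ} (hD : D ≠ 0) (h : D ∣ x - z) : |nearMod D x| ≤ |z| := by
  by_contra! hlt
  have h1 : D ∣ nearMod D x - z := by
    have := dvd_sub h (dvd_sub_nearMod D x)
    rwa [sub_sub_sub_cancel_left] at this
  have h2 := two_mul_abs_nearMod_le hD x
  have h3 : |nearMod D x - z| < |D| := by
    have := abs_sub (nearMod D x) z
    linarith
  have h4 := Int.eq_zero_of_abs_lt_dvd ((abs_dvd _ _).2 h1) h3
  rw [sub_eq_zero.1 h4] at hlt
  exact lt_irrefl _ hlt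

/-! ### One elimination step -/

/-- The multiple of row `t` to be subtracted from row `i`. -/
def elimQuot (D : ℤ) (t i : ℤ) (W : ℤ → ℤ → ℤ) : ℤ := nearQuot (W i t) (W t t) % D

/-- Subtract a multiple of row `t` from row `i`, modulo `D`. -/
def elimRow (D : ℤ) (t i : ℤ) (W : ℤ → ℤ → ℤ) : ℤ → ℤ → ℤ :=
  fun r j => if r = i then nearMod D (W i j - elimQuot D t i W * W t j) else W r j

/-- One step of the Euclidean algorithm on the rows `t` and `i`, modulo `D`. -/
def elimStep (D : ℤ) (t i : ℤ) (W : ℤ → ℤ → ℤ) : ℤ → ℤ → ℤ :=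
  if elimRow D t i W i t = 0 then elimRow D t i W
  else fun r => elimRow D t i W (Equiv.swap i t r)

/-- The action of `elimStep` on the generators. -/
def elimGen {G : Type*} [Group G] (D : ℤ) (t i : ℤ) (W : ℤ → ℤ → ℤ) (g : ℤ → G) : ℤ → G :=
  let g' : ℤ → G := fun r => if r = t then g t * g i ^ elimQuot D t i W else g r
  if elimRow D t i W i t = 0 then g' else fun r => g' (Equiv.swap i t r)

theorem elimRow_pivot_dvd {D t i : ℤ} (W : ℤ → ℤ → ℤ) :
    D ∣ (W i t - elimQuot D t i W * W t t) - (W i t - W t t * nearQuot (W i t) (W t t)) := by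
  have h := Int.emod_add_mul_ediv (nearQuot (W i t) (W t t)) D
  refine ⟨nearQuot (W i t) (W t t) / D * W t t, ?_⟩
  rw [elimQuot]
  linear_combination (- W t t) * h

theorem two_mul_abs_elimRow_le {D t i : ℤ} {W : ℤ → ℤ → ℤ} (hD : D ≠ 0) (hp : W t t ≠ 0) :
    2 * |elimRow D t i W i t| ≤ |W t t| := by
  have h1 := two_mul_abs_sub_mul_nearQuot_le (W i t) hp
  have h2 := abs_nearMod_le hD (elimRow_pivot_dvd (D := D) (t := t) (i := i) W)
  simp only [elimRow, if_true]
  linarith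

theorem elimRow_eq_zero {D t i : ℤ} {W : ℤ → ℤ → ℤ} (h : W i t = 0) :
    elimRow D t i W i t = 0 := by
  simp [elimRow, elimQuot, h, nearQuot_zero_left]

/-- Row and column `t` have been cleared, except for the pivot. -/
def Cleared (t : ℤ) (W : ℤ → ℤ → ℤ) : Prop := ∀ i, t < i → W i t = 0 ∧ W t i = 0

theorem Cleared.transpose {t : ℤ} {W : ℤ → ℤ → ℤ} (h : Cleared t W) :
    Cleared t fun i j => W j i := fun i hi => (h i hi).symm

/-- The effect of `elimStep` on row and column `t`: the rows are swapped and the pivot gets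
smaller, or entry `i` of column `t` is cleared and nothing else changes. -/
theorem elimStep_pivot {D t i : ℤ} (hD : 0 < D) (hi : t < i) (W : ℤ → ℤ → ℤ) :
    (¬ Cleared t W ∧ elimStep D t i W t t ≠ 0 ∧ |elimStep D t i W t t| ≤ D ∧
      (W t t = 0 ∨ 2 * |elimStep D t i W t t| ≤ |W t t|)) ∨
    (elimStep D t i W t = W t ∧ elimStep D t i W i t = 0 ∧
      ∀ r, r ≠ i → elimStep D t i W r t = W r t) := by
  by_cases h : elimRow D t i W i t = 0
  · right
    simp only [elimStep, h, if_true]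
    refine ⟨?_, trivial, fun r hr => ?_⟩
    · funext j; simp [elimRow, hi.ne]
    · simp [elimRow, hr]
  · left
    simp only [elimStep, h, if_false, Equiv.swap_apply_right]
    refine ⟨fun hc => h (elimRow_eq_zero (hc i hi).1), h, ?_, ?_⟩
    · have := two_mul_abs_nearMod_le hD.ne' (W i t - elimQuot D t i W * W t t)
      simp only [elimRow, if_true]
      rw [abs_of_pos hD] at this
      have := abs_nonneg (nearMod D (W i t - elimQuot D t i W * W t t))
      linarith
    · exact or_iff_not_imp_left.2 fun hp => two_mul_abs_elimRow_le hD.ne' hp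

/-! ### Relations between generators -/

/-- The entries of `W` outside of the first `k` rows and `n` columns vanish. -/
def Supported (k n : ℤ) (W : ℤ → ℤ → ℤ) : Prop :=
  ∀ i j, W i j ≠ 0 → (0 ≤ i ∧ i < k) ∧ (0 ≤ j ∧ j < n)

/-- Outside of the diagonal the first `t` rows and columns of `W` vanish. -/
def DiagUpTo (t : ℤ) (W : ℤ → ℤ → ℤ) : Prop := ∀ i j, i ≠ j → (i < t ∨ j < t) → W i j = 0

theorem Supported.transpose {k n : ℤ} {W : ℤ → ℤ → ℤ} (h : Supported k n W) :
    Supported n k fun i j => W j i := fun i j hij => (h j i hij).symm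

theorem DiagUpTo.transpose {t : ℤ} {W : ℤ → ℤ → ℤ} (h : DiagUpTo t W) :
    DiagUpTo t fun i j => W j i := fun i j hij ht => h j i hij.symm ht.symm

theorem Supported.elimStep {k n D t i : ℤ} {W : ℤ → ℤ → ℤ} (h : Supported k n W)
    (ht : 0 ≤ t) (hi : t < i) (hik : i < k) : Supported k n (elimStep D t i W) := by
  have h1 : Supported k n (elimRow D t i W) := by
    intro r j hr
    by_cases hri : r = i
    · subst hri
      refine ⟨⟨by omega, hik⟩, ?_⟩
      by_contra hj
      have h2 : W r j = 0 := by by_contra h3; exact hj (h _ _ h3).2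
      have h3 : W t j = 0 := by by_contra h3; exact hj (h _ _ h3).2
      exact hr (by simp [elimRow, h2, h3])
    · simp only [elimRow, if_neg hri] at hr
      exact h _ _ hr
  unfold _root_.elimStep
  split_ifs
  · exact h1
  · intro r j hr
    have h2 := h1 _ _ hr
    refine ⟨?_, h2.2⟩
    rcases eq_or_ne r i with rfl | hri
    · omega
    rcases eq_or_ne r t with rfl | hrt
    · omega
    rw [Equiv.swap_apply_of_ne_of_ne hri hrt] at h2
    exact h2.1

theorem DiagUpTo.elimStep {D t i : ℤ} {W : ℤ → ℤ → ℤ} (h : DiagUpTo t W)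
    (hi : t < i) : DiagUpTo t (elimStep D t i W) := by
  have h1 : DiagUpTo t (elimRow D t i W) := by
    intro r j hrj ht
    by_cases hri : r = i
    · subst hri
      have h2 : W r j = 0 := h _ _ hrj ht
      have h3 : W t j = 0 := h _ _ (by omega) (by omega)
      simp [elimRow, h2, h3]
    · simp only [elimRow, if_neg hri]
      exact h _ _ hrj ht
  unfold _root_.elimStep
  split_ifs
  · exact h1
  · intro r j hrj ht
    beta_reduce
    rcases eq_or_ne r i with rfl | hri
    · rw [Equiv.swap_apply_left]
      exact h1 _ _ (by omega) (by omega)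
    rcases eq_or_ne r t with rfl | hrt
    · rw [Equiv.swap_apply_right]
      exact h1 _ _ (by omega) (by omega)
    rw [Equiv.swap_apply_of_ne_of_ne hri hrt]
    exact h1 _ _ hrj ht

open Finset in
/-- The vector `x` is a combination of the columns of `W`, modulo `D`. -/
def InLattice (k n D : ℤ) (W : ℤ → ℤ → ℤ) (x : ℤ → ℤ) : Prop :=
  ∃ y z : ℤ → ℤ, ∀ i ∈ Ico 0 k, x i = ∑ j ∈ Ico 0 n, W i j * y j + D * z i

open Finset in
/-- The elements `g 0, …, g (k - 1)` generate `G`, and their relations are the combinations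
of the columns of `W`, modulo `D`. -/
structure Presents {G : Type*} [CommGroup G] (k n D : ℤ) (W : ℤ → ℤ → ℤ) (g : ℤ → G) : Prop where
  gen : ∀ h : G, ∃ x : ℤ → ℤ, ∏ i ∈ Ico 0 k, g i ^ x i = h
  rel : ∀ x : ℤ → ℤ, ∏ i ∈ Ico 0 k, g i ^ x i = 1 ↔ InLattice k n D W x

section Presents

open Finset

variable {G : Type*} [CommGroup G] {k n D t i : ℤ} {W : ℤ → ℤ → ℤ} {g : ℤ → G}

theorem prod_mul_zpow (ht : t ∈ Ico 0 k) (hi : i ∈ Ico 0 k) (q : ℤ)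
    (x : ℤ → ℤ) :
    ∏ r ∈ Ico 0 k, (if r = t then g t * g i ^ q else g r) ^ x r =
      ∏ r ∈ Ico 0 k, g r ^ (if r = i then x i + q * x t else x r) := by
  have h1 : ∀ r ∈ Ico 0 k, (if r = t then g t * g i ^ q else g r) ^ x r =
      g r ^ x r * if r = t then g i ^ (q * x t) else 1 := by
    intro r _
    split_ifs with h
    · rw [h, mul_zpow, zpow_mul]
    · simp
  have h2 : ∀ r ∈ Ico 0 k, g r ^ (if r = i then x i + q * x t else x r) =
      g r ^ x r * if r = i then g i ^ (q * x t) else 1 := by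
    intro r _
    split_ifs with h
    · rw [h, zpow_add]
    · simp
  rw [prod_congr rfl h1, prod_congr rfl h2, prod_mul_distrib, prod_mul_distrib, prod_ite_eq',
    prod_ite_eq', if_pos ht, if_pos hi]

theorem swap_mem_iff (ht : t ∈ Ico 0 k) (hi : i ∈ Ico 0 k) (r : ℤ) :
    r ∈ Ico 0 k ↔ Equiv.swap i t r ∈ Ico 0 k := by
  rcases eq_or_ne r i with rfl | hri
  · simp only [Equiv.swap_apply_left, hi, ht]
  rcases eq_or_ne r t with rfl | hrt
  · simp only [Equiv.swap_apply_right, hi, ht]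
  rw [Equiv.swap_apply_of_ne_of_ne hri hrt]

theorem prod_swap (ht : t ∈ Ico 0 k) (hi : i ∈ Ico 0 k) (x : ℤ → ℤ) :
    ∏ r ∈ Ico 0 k, g (Equiv.swap i t r) ^ x r = ∏ r ∈ Ico 0 k, g r ^ x (Equiv.swap i t r) :=
  prod_equiv (Equiv.swap i t) (swap_mem_iff ht hi) fun r _ => by simp

theorem Presents.swap (h : Presents k n D W g) (ht : t ∈ Ico 0 k) (hi : i ∈ Ico 0 k) :
    Presents k n D (fun r => W (Equiv.swap i t r)) fun r => g (Equiv.swap i t r) := by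
  refine ⟨fun y => ?_, fun x => ?_⟩
  · obtain ⟨x, hx⟩ := h.gen y
    exact ⟨fun r => x (Equiv.swap i t r), by rw [prod_swap ht hi]; simpa using hx⟩
  · rw [prod_swap ht hi, h.rel]
    constructor
    · rintro ⟨y, z, hyz⟩
      refine ⟨y, fun r => z (Equiv.swap i t r), fun r hr => ?_⟩
      simpa using hyz _ ((swap_mem_iff ht hi r).1 hr)
    · rintro ⟨y, z, hyz⟩
      refine ⟨y, fun r => z (Equiv.swap i t r), fun r hr => ?_⟩
      simpa using hyz _ ((swap_mem_iff ht hi r).1 hr)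

theorem Presents.elimRow (h : Presents k n D W g) (ht : t ∈ Ico 0 k) (hi : i ∈ Ico 0 k)
    (hti : t ≠ i) :
    Presents k n D (elimRow D t i W)
      fun r => if r = t then g t * g i ^ elimQuot D t i W else g r := by
  set q := elimQuot D t i W with hq
  choose c hc using fun x => dvd_sub_nearMod D x
  have hcol : ∀ y : ℤ → ℤ, ∑ j ∈ Ico 0 n, W i j * y j =
      ∑ j ∈ Ico 0 n, _root_.elimRow D t i W i j * y j + q * ∑ j ∈ Ico 0 n, W t j * y j + D * ∑ j ∈ Ico 0 n, c (W i j - q * W t j) * y j := by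
    intro y
    rw [mul_sum, mul_sum, ← sum_add_distrib, ← sum_add_distrib]
    refine sum_congr rfl fun j _ => ?_
    have := hc (W i j - q * W t j)
    simp only [_root_.elimRow, if_true, ← hq]
    linear_combination (y j) * this
  have hrow : ∀ r, r ≠ i → _root_.elimRow D t i W r = W r := fun r hr => by
    funext j; simp [_root_.elimRow, hr]
  refine ⟨fun y => ?_, fun x => ?_⟩
  · obtain ⟨x, hx⟩ := h.gen y
    refine ⟨fun r => if r = i then x i - q * x t else x r, ?_⟩
    rw [prod_mul_zpow ht hi, ← hx]
    refine prod_congr rfl fun r _ => ?_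
    rcases eq_or_ne r i with rfl | hr
    · simp [hti]
    · simp [hr]
  · rw [prod_mul_zpow ht hi, h.rel]
    constructor
    · rintro ⟨y, z, hyz⟩
      refine ⟨y, fun r => if r = i then z i - q * z t + ∑ j ∈ Ico 0 n, c (W i j - q * W t j) * y j
        else z r, fun r hr => ?_⟩
      beta_reduce at hyz ⊢
      split_ifs with hri
      · subst hri
        have h1 := hyz r hr
        have h2 := hyz t ht
        rw [if_pos rfl, hcol] at h1
        rw [if_neg hti] at h2
        linear_combination h1 - q * h2
      · have h1 := hyz r hr
        rw [if_neg hri] at h1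
        rw [h1, hrow r hri]
    · rintro ⟨y, z, hyz⟩
      refine ⟨y, fun r => if r = i then z i + q * z t - ∑ j ∈ Ico 0 n, c (W i j - q * W t j) * y j
        else z r, fun r hr => ?_⟩
      beta_reduce at hyz ⊢
      split_ifs with hri
      · subst hri
        have h1 := hyz r hr
        have h2 := hyz t ht
        rw [hrow t hti] at h2
        rw [hcol]
        linear_combination h1 + q * h2
      · have h1 := hyz r hr
        rw [hrow r hri] at h1
        rw [h1]

theorem Presents.elimStep (h : Presents k n D W g) (ht : t ∈ Ico 0 k) (hi : i ∈ Ico 0 k)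
    (hti : t ≠ i) : Presents k n D (elimStep D t i W) (elimGen D t i W g) := by
  unfold _root_.elimStep elimGen
  split_ifs
  · exact h.elimRow ht hi hti
  · exact (h.elimRow ht hi hti).swap ht hi

theorem Presents.of_inLattice {W' : ℤ → ℤ → ℤ} (h : Presents k n D W g)
    (h1 : ∀ x, InLattice k n D W x → InLattice k n D W' x)
    (h2 : ∀ x, InLattice k n D W' x → InLattice k n D W x) : Presents k n D W' g :=
  ⟨h.gen, fun x => (h.rel x).trans ⟨h1 x, h2 x⟩⟩

theorem Presents.elimStep_transpose (h : Presents k n D W g) (ht : t ∈ Ico 0 n)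
    (hi : i ∈ Ico 0 n) (hti : t ≠ i) :
    Presents k n D (fun r j => _root_.elimStep D t i (fun r j => W j r) j r) g := by
  set V := fun r j => W j r with hV
  set q := elimQuot D t i V with hq
  choose c hc using fun x => dvd_sub_nearMod D x
  have key : Presents k n D (fun r j => _root_.elimRow D t i V j r) g := by
    have hE : ∀ r j, _root_.elimRow D t i V j r = W r j +
        if j = i then - q * W r t - D * c (W r i - q * W r t) else 0 := by
      intro r j
      simp only [_root_.elimRow]
      split_ifs with hj
      · subst hj
        have := hc (W r j - q * W r t)
        simp only [hV]
        linear_combination -this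
      · simp [hV]
    have hS : ∀ r, ∀ y : ℤ → ℤ, ∑ j ∈ Ico 0 n, _root_.elimRow D t i V j r * y j =
        ∑ j ∈ Ico 0 n, W r j * y j + (- q * W r t - D * c (W r i - q * W r t)) * y i := by
      intro r y
      simp only [hE, add_mul, sum_add_distrib, ite_mul, zero_mul, sum_ite_eq', if_pos hi]
    have hT : ∀ r, ∀ y : ℤ → ℤ, ∀ v, ∑ j ∈ Ico 0 n, W r j * (if j = t then y t + v else y j) =
        ∑ j ∈ Ico 0 n, W r j * y j + W r t * v := by
      intro r y v
      have : ∀ j ∈ Ico 0 n, W r j * (if j = t then y t + v else y j) = W r j * y j +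
          if j = t then W r t * v else 0 := by
        intro j _
        split_ifs with h
        · rw [h]; ring
        · ring
      rw [sum_congr rfl this, sum_add_distrib, sum_ite_eq', if_pos ht]
    refine h.of_inLattice ?_ ?_
    · rintro x ⟨y, z, hyz⟩
      refine ⟨fun j => if j = t then y t + q * y i else y j,
        fun r => z r + c (W r i - q * W r t) * y i, fun r hr => ?_⟩
      rw [hS, hT, hyz r hr, if_neg hti.symm]
      ring
    · rintro x ⟨y, z, hyz⟩
      refine ⟨fun j => if j = t then y t + - q * y i else y j,
        fun r => z r - c (W r i - q * W r t) * y i, fun r hr => ?_⟩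
      rw [hT, hyz r hr, hS]
      ring
  unfold _root_.elimStep
  split_ifs
  · exact key
  · refine key.of_inLattice ?_ ?_
    · rintro x ⟨y, z, hyz⟩
      refine ⟨fun r => y (Equiv.swap i t r), z, fun r hr => ?_⟩
      rw [hyz r hr]
      congr 1
      exact (sum_equiv (Equiv.swap i t) (swap_mem_iff ht hi) fun r _ => by simp).symm
    · rintro x ⟨y, z, hyz⟩
      refine ⟨fun r => y (Equiv.swap i t r), z, fun r hr => ?_⟩
      rw [hyz r hr]
      congr 1
      exact (sum_equiv (Equiv.swap i t) (swap_mem_iff ht hi) fun r _ => by simp)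

theorem Presents.zpow_eq_one_of_diag (h : Presents k n D W g) (hkn : k ≤ n) (hW : DiagUpTo k W)
    {x : ℤ → ℤ} (hx : ∏ i ∈ Ico 0 k, g i ^ x i = 1) (hi : i ∈ Ico 0 k) : g i ^ x i = 1 := by
  obtain ⟨y, z, hyz⟩ := (h.rel x).1 hx
  have hsum : ∀ r ∈ Ico 0 k, ∀ y : ℤ → ℤ, ∑ j ∈ Ico 0 n, W r j * y j = W r r * y r := by
    intro r hr y
    rw [mem_Ico] at hr
    refine sum_eq_single r (fun j _ hj => ?_) fun hn => absurd (mem_Ico.2 (by omega)) hn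
    rw [hW r j hj.symm (Or.inl hr.2), zero_mul]
  have key : InLattice k n D W (fun r => if r = i then x i else 0) := by
    refine ⟨fun r => if r = i then y i else 0, fun r => if r = i then z i else 0, fun r hr => ?_⟩
    rw [hsum r hr]
    beta_reduce
    split_ifs with hri
    · subst hri; rw [hyz r hr, hsum r hr]
    · simp
  have := (h.rel _).2 key
  simpa [prod_ite_eq', hi, apply_ite] using this

end Presents

@[to_additive]
theorem prod_Ico_int_eq_prod_fin {M : Type*} [CommMonoid M] (k : ℕ) (f : ℤ → M) :
    ∏ r ∈ Finset.Ico 0 (k : ℤ), f r = ∏ i : Fin k, f (i : ℕ) := by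
  symm
  refine Finset.prod_nbij (fun i : Fin k => ((i : ℕ) : ℤ)) (fun i _ => ?_) (fun i _ j _ h => ?_)
    (fun r hr => ?_) fun i _ => rfl
  · simp
  · simpa [Fin.ext_iff] using h
  · rw [Finset.mem_coe, Finset.mem_Ico] at hr
    exact ⟨⟨r.toNat, by omega⟩, by simp, by simp [hr.1]⟩

theorem sum_Ico_int_succ {r : ℤ} (hr : 0 ≤ r) (f : ℤ → ℤ) :
    ∑ j ∈ Finset.Ico 0 (r + 1), f j = ∑ j ∈ Finset.Ico 0 r, f j + f r := by
  rw [← Order.succ_eq_add_one, ← Finset.insert_Ico_right_eq_Ico_succ hr,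
    Finset.sum_insert Finset.right_notMem_Ico, add_comm]

theorem abs_sum_Ico_int_le {r b : ℤ} (hr : 0 ≤ r) {f : ℤ → ℤ}
    (hf : ∀ j, 0 ≤ j → j < r → |f j| ≤ b) : |∑ j ∈ Finset.Ico 0 r, f j| ≤ r * b := by
  refine (Finset.abs_sum_le_sum_abs _ _).trans ?_
  refine (Finset.sum_le_card_nsmul _ _ b fun j hj => ?_).trans ?_
  · rw [Finset.mem_Ico] at hj; exact hf j hj.1 hj.2
  · simp [hr]

/-! ### The algorithm of Faddeev and LeVerrier without divisions -/

/-- The matrices and traces of the Faddeev-LeVerrier algorithm, scaled by factorials. -/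
noncomputable def faddeev (k : ℤ) (A : ℤ → ℤ → ℤ) : ℕ → (ℤ → ℤ → ℤ) × ℤ
  | 0 => (0, 1)
  | l + 1 =>
    let C : ℤ → ℤ → ℤ := fun u v => (faddeev k A l).2 * A u v -
      l * ∑ r ∈ Finset.Ico 0 k, A u r * (faddeev k A l).1 r v
    (C, ∑ u ∈ Finset.Ico 0 k, C u u)

theorem faddeev_succ_fst (k : ℤ) (A : ℤ → ℤ → ℤ) (l : ℕ) (u v : ℤ) :
    (faddeev k A (l + 1)).1 u v = (faddeev k A l).2 * A u v -
      l * ∑ r ∈ Finset.Ico 0 k, A u r * (faddeev k A l).1 r v := rfl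

theorem faddeev_succ_snd (k : ℤ) (A : ℤ → ℤ → ℤ) (l : ℕ) :
    (faddeev k A (l + 1)).2 = ∑ u ∈ Finset.Ico 0 k, (faddeev k A (l + 1)).1 u u := rfl

theorem faddeev_bound {k a : ℤ} (hk : 0 ≤ k) (ha : 0 ≤ a) {A : ℤ → ℤ → ℤ}
    (hA : ∀ u v, 0 ≤ u → u < k → 0 ≤ v → v < k → |A u v| ≤ a) (l : ℕ) (hl : l < k) :
    (∀ u v, 0 ≤ u → u < k → 0 ≤ v → v < k →
      |(faddeev k A (l + 1)).1 u v| ≤ a * (k * k * a) ^ l) ∧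
    |(faddeev k A (l + 1)).2| ≤ k * (a * (k * k * a) ^ l) := by
  have main : ∀ u v, 0 ≤ u → u < k → 0 ≤ v → v < k →
      |(faddeev k A (l + 1)).1 u v| ≤ a * (k * k * a) ^ l := by
    induction l with
    | zero =>
      intro u v hu hu' hv hv'
      simpa [faddeev] using hA u v hu hu' hv hv'
    | succ l ih =>
      intro u v hu hu' hv hv'
      have ih := ih (by push_cast at hl; omega)
      set h := a * (k * k * a) ^ l with hh
      have hh0 : 0 ≤ h := by positivity
      have h1 : |(faddeev k A (l + 1)).2| ≤ k * h := by
        rw [faddeev_succ_snd]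
        exact abs_sum_Ico_int_le hk fun u h0 h1 => ih u u h0 h1 h0 h1
      have h2 : |∑ r ∈ Finset.Ico 0 k, A u r * (faddeev k A (l + 1)).1 r v| ≤ k * (a * h) := by
        refine abs_sum_Ico_int_le hk fun r h0 h1 => ?_
        rw [abs_mul]
        exact mul_le_mul (hA u r hu hu' h0 h1) (ih r v h0 h1 hv hv') (abs_nonneg _) ha
      rw [faddeev_succ_fst, pow_succ, ← mul_assoc, ← hh]
      refine (abs_sub _ _).trans ?_
      rw [abs_mul, abs_mul]
      have h3 := mul_le_mul h1 (hA u v hu hu' hv hv') (abs_nonneg _) (by positivity)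
      have h4 : |((l + 1 : ℕ) : ℤ)| * |∑ r ∈ Finset.Ico 0 k, A u r * (faddeev k A (l + 1)).1 r v| ≤
          (k - 1) * (k * (a * h)) := by
        refine mul_le_mul ?_ h2 (abs_nonneg _) (by push_cast at hl; omega)
        rw [abs_of_nonneg (by positivity)]; omega
      calc _ ≤ k * h * a + (k - 1) * (k * (a * h)) := add_le_add h3 h4
        _ = h * (k * k * a) := by ring
  refine ⟨main, ?_⟩
  rw [faddeev_succ_snd]
  exact abs_sum_Ico_int_le hk fun u h0 h1 => main u u h0 h1 h0 h1

open Matrix Finset in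
theorem faddeev_eq_factorial_mul_det {k : ℕ} (A : ℤ → ℤ → ℤ)
    (hA : ∀ i j : Fin k, A (i : ℕ) (j : ℕ) = A (j : ℕ) (i : ℕ)) :
    (faddeev k A k).2 =
      k.factorial * (Matrix.of fun i j : Fin k => A (i : ℕ) (j : ℕ)).det := by
  set B : Matrix (Fin k) (Fin k) ℝ := Matrix.of fun i j => (A (i : ℕ) (j : ℕ) : ℝ) with hB
  have hH : B.IsHermitian := by
    ext i j; simp [hB, hA i j]
  set ev := hH.eigenvalues with hev
  obtain ⟨U, V, hVU, hUV, hspec⟩ : ∃ U V : Matrix (Fin k) (Fin k) ℝ, V * U = 1 ∧ U * V = 1 ∧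
      B = U * diagonal ev * V := by
    refine ⟨hH.eigenvectorUnitary, star (hH.eigenvectorUnitary : Matrix (Fin k) (Fin k) ℝ),
      Unitary.coe_star_mul_self _, Unitary.coe_mul_star_self _, ?_⟩
    conv_lhs => rw [hH.spectral_theorem, Unitary.conjStarAlgAut_apply]
    rfl
  let C : ℕ → Matrix (Fin k) (Fin k) ℝ := fun l =>
    Matrix.of fun i j => ((faddeev k A l).1 (i : ℕ) (j : ℕ) : ℝ)
  let c : ℕ → ℝ := fun l => ((faddeev k A l).2 : ℝ)
  let e : ℕ → ℝ := fun l => ∑ S ∈ powersetCard l univ, ∏ i ∈ S, ev i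
  let f : ℕ → Fin k → ℝ := fun l a => ∑ S ∈ powersetCard l univ with a ∈ S, ∏ i ∈ S, ev i
  have hC : ∀ l, C (l + 1) = B * (c l • 1 - (l : ℝ) • C l) := by
    intro l
    ext i j
    rw [mul_sub, Matrix.mul_smul, Matrix.mul_smul, mul_one]
    simp only [C, c, hB, Matrix.of_apply, Matrix.sub_apply, Matrix.smul_apply, Matrix.mul_apply,
      faddeev_succ_fst, sum_Ico_int_eq_sum_fin, smul_eq_mul]
    push_cast
    rfl
  have hc : ∀ l, c (l + 1) = (C (l + 1)).trace := by
    intro l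
    simp only [C, c, Matrix.trace, Matrix.diag, Matrix.of_apply, faddeev_succ_snd,
      sum_Ico_int_eq_sum_fin]
    push_cast
    rfl
  have hf : ∀ l a, f (l + 1) a = ev a * (e l - f l a) := by
    intro l a
    have h1 : e l - f l a = ∑ S ∈ powersetCard l univ with a ∉ S, ∏ i ∈ S, ev i := by
      rw [sub_eq_iff_eq_add']
      exact (sum_filter_add_sum_filter_not _ _ _).symm
    rw [h1, mul_sum]
    symm
    refine sum_bij' (fun S _ => insert a S) (fun S _ => S.erase a) ?_ ?_ ?_ ?_ ?_
    · intro S hS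
      simp only [mem_filter, mem_powersetCard_univ] at hS ⊢
      exact ⟨by rw [card_insert_of_notMem hS.2, hS.1], mem_insert_self _ _⟩
    · intro S hS
      simp only [mem_filter, mem_powersetCard_univ] at hS ⊢
      exact ⟨by rw [card_erase_of_mem hS.2, hS.1]; rfl, notMem_erase _ _⟩
    · intro S hS
      exact erase_insert (mem_filter.1 hS).2
    · intro S hS
      exact insert_erase (mem_filter.1 hS).2
    · intro S hS
      exact (prod_insert (mem_filter.1 hS).2).symm
  have hsum : ∀ l, ∑ a, f l a = l * e l := by
    intro l
    simp only [f, sum_filter, e]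
    rw [sum_comm, mul_sum]
    refine sum_congr rfl fun S hS => ?_
    rw [sum_ite_mem, univ_inter, sum_const, (mem_powersetCard.1 hS).2, nsmul_eq_mul]
  have key : ∀ l, c l = l.factorial * e l ∧
      (l : ℝ) • C l = U * diagonal (fun a => (l.factorial : ℝ) * f l a) * V := by
    intro l
    induction l with
    | zero =>
      constructor
      · simp [c, e, faddeev]
      · have : (fun a => ((0 : ℕ).factorial : ℝ) * f 0 a) = 0 := by
          funext a
          simp [f, sum_filter]
        rw [this]
        ext; simp
    | succ l ih =>
      have h1 : C (l + 1) = U * diagonal (fun a => (l.factorial : ℝ) * f (l + 1) a) * V := by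
        have h2 : c l • (1 : Matrix (Fin k) (Fin k) ℝ) =
            U * diagonal (fun _ => (l.factorial : ℝ) * e l) * V := by
          rw [← ih.1]
          have : diagonal (fun _ : Fin k => c l) = c l • (1 : Matrix (Fin k) (Fin k) ℝ) := by
            rw [smul_one_eq_diagonal]
          rw [this, Matrix.mul_smul, mul_one, Matrix.smul_mul, hUV]
        rw [hC, ih.2, h2, ← Matrix.sub_mul, ← Matrix.mul_sub, diagonal_sub, hspec]
        calc _ = U * (diagonal ev * ((V * U) *
              diagonal fun a => l.factorial * e l - l.factorial * f l a)) * V := by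
              simp only [Matrix.mul_assoc]
          _ = _ := by
              rw [hVU, Matrix.one_mul, diagonal_mul_diagonal]
              congr 3
              funext a
              rw [hf]; ring
      constructor
      · rw [hc, h1, Matrix.trace_mul_comm, ← Matrix.mul_assoc, hVU, Matrix.one_mul, trace_diagonal,
          ← mul_sum, hsum, Nat.factorial_succ]
        push_cast
        ring
      · rw [h1, ← Matrix.smul_mul, ← Matrix.mul_smul, ← diagonal_smul, Nat.factorial_succ]
        congr 3
        funext a
        simp only [Pi.smul_apply, smul_eq_mul]
        push_cast
        ring
  have hdet : B.det = e k := by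
    rw [hH.det_eq_prod_eigenvalues]
    have : powersetCard k (univ : Finset (Fin k)) = {univ} := by
      have := powersetCard_self (univ : Finset (Fin k))
      rwa [card_univ, Fintype.card_fin] at this
    simp only [e, this, sum_singleton]
    rfl
  have h1 := (key k).1
  rw [← hdet] at h1
  have h2 : B = (Matrix.of fun i j : Fin k => A (i : ℕ) (j : ℕ)).map (Int.castRingHom ℝ) := rfl
  rw [h2, ← RingHom.mapMatrix_apply, ← RingHom.map_det] at h1
  simp only [c, eq_intCast] at h1
  exact_mod_cast h1

open Matrix in
theorem det_mul_transpose_ne_zero {k n : ℕ} (M : Matrix (Fin k) (Fin n) ℤ) {N : ℤ} (hN : N ≠ 0)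
    (h : ∀ i : Fin k, Pi.single i N ∈ intcol M) : (M * Mᵀ).det ≠ 0 := by
  intro h0
  obtain ⟨v, hv, hMv⟩ := Matrix.exists_mulVec_eq_zero_iff.2 h0
  refine hv ?_
  have h1 : Mᵀ *ᵥ v = 0 := by
    have : (Mᵀ *ᵥ v) ⬝ᵥ (Mᵀ *ᵥ v) = 0 := by
      rw [Matrix.dotProduct_mulVec, Matrix.vecMul_transpose, Matrix.mulVec_mulVec, hMv,
        zero_dotProduct]
    exact dotProduct_self_eq_zero.1 this
  have h2 : ∀ x ∈ intcol M, v ⬝ᵥ x = 0 := by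
    intro x hx
    induction hx using Submodule.span_induction with
    | mem x hx =>
      obtain ⟨j, rfl⟩ := hx
      have := congrFun h1 j
      rw [dotProduct_comm]
      exact this
    | zero => simp
    | add x y _ _ hx hy => rw [dotProduct_add, hx, hy, add_zero]
    | smul c x _ hx => rw [dotProduct_smul, hx, smul_zero]
  funext i
  have := h2 _ (h i)
  rw [dotProduct_single] at this
  exact (mul_eq_zero.1 this).resolve_right hN

open Matrix in
theorem mem_intcol_iff {k n : ℕ} {M : Matrix (Fin k) (Fin n) ℤ} {x : Fin k → ℤ} :
    x ∈ intcol M ↔ ∃ y, M *ᵥ y = x := by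
  rw [intcol, ← Matrix.range_mulVecLin]
  rfl

open Matrix in
theorem det_smul_mem_intcol {k n : ℕ} (M : Matrix (Fin k) (Fin n) ℤ) (z : Fin k → ℤ) :
    (M * Mᵀ).det • z ∈ intcol M := by
  refine mem_intcol_iff.2 ⟨Mᵀ *ᵥ ((M * Mᵀ).adjugate *ᵥ z), ?_⟩
  rw [Matrix.mulVec_mulVec, Matrix.mulVec_mulVec, Matrix.mul_adjugate, Matrix.smul_mulVec,
    Matrix.one_mulVec]

theorem isInternal_zmultiples {G : Type*} [CommGroup G] {k : ℕ} (g : Fin k → G)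
    (hgen : ∀ h, ∃ x : Fin k → ℤ, ∏ i, g i ^ x i = h)
    (hrel : ∀ x : Fin k → ℤ, ∏ i, g i ^ x i = 1 → ∀ i, g i ^ x i = 1) :
    DirectSum.IsInternal
      (fun i : Fin k => AddSubgroup.zmultiples (Additive.ofMul (g i))) := by
  have hcoe : ∀ x : DirectSum (Fin k) fun i => AddSubgroup.zmultiples (Additive.ofMul (g i)),
      DirectSum.coeAddMonoidHom (fun i => AddSubgroup.zmultiples (Additive.ofMul (g i))) x =
        ∑ i, (x i : Additive G) := by
    intro x
    classical
    rw [DirectSum.coeAddMonoidHom_eq_dfinsuppSum]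
    exact DFinsupp.sum_eq_sum_fintype _ fun _ => rfl
  constructor
  · rw [injective_iff_map_eq_zero]
    intro x hx
    rw [hcoe] at hx
    choose m hm using fun i => AddSubgroup.mem_zmultiples_iff.1 (x i).2
    have h1 : ∏ i, g i ^ m i = 1 := by
      have : ∑ i, m i • Additive.ofMul (g i) = 0 := by
        rw [← hx]; exact Finset.sum_congr rfl fun i _ => hm i
      exact this
    refine DFinsupp.ext fun i => Subtype.ext ?_
    rw [← hm i]
    exact hrel m h1 i
  · intro h
    obtain ⟨m, hm⟩ := hgen (Additive.toMul h)
    refine ⟨∑ i, DirectSum.of _ i ⟨m i • Additive.ofMul (g i),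
      AddSubgroup.zsmul_mem_zmultiples _ _⟩, ?_⟩
    rw [map_sum]
    simp only [DirectSum.coeAddMonoidHom_of]
    exact hm

namespace GroupRAM

namespace Expr

instance : Add Expr := ⟨.bin .add⟩
instance : Sub Expr := ⟨.bin .sub⟩
instance : Mul Expr := ⟨.bin .mul⟩
instance : Div Expr := ⟨.bin .div⟩
instance : Mod Expr := ⟨.bin .mod⟩

variable {G : Type*} (s : State G)

theorem eval_add (e₁ e₂ : Expr) : (e₁ + e₂).eval s = e₁.eval s + e₂.eval s := rfl
theorem eval_sub (e₁ e₂ : Expr) : (e₁ - e₂).eval s = e₁.eval s - e₂.eval s := rfl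
theorem eval_mul (e₁ e₂ : Expr) : (e₁ * e₂).eval s = e₁.eval s * e₂.eval s := rfl
theorem eval_div (e₁ e₂ : Expr) : (e₁ / e₂).eval s = e₁.eval s / e₂.eval s := rfl
theorem eval_mod (e₁ e₂ : Expr) : (e₁ % e₂).eval s = e₁.eval s % e₂.eval s := rfl
theorem eval_lit (c : ℤ) : (lit c).eval s = c := rfl
theorem eval_var (x : ℕ) : (var x).eval s = s.var x := rfl
theorem eval_cell (A : ℕ) (i j : Expr) :
    (cell A i j).eval s = s.arr A (i.eval s) (j.eval s) := rfl

/-- An expression for `nearQuot`. -/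
def nearQuot (x p : Expr) : Expr := (lit 2 * x * p + p * p) / (lit 2 * (p * p))

/-- An expression for `nearMod`. -/
def nearMod (D x : Expr) : Expr := x - D * nearQuot x D

theorem eval_nearQuot (x p : Expr) :
    (nearQuot x p).eval s = _root_.nearQuot (x.eval s) (p.eval s) := rfl

theorem eval_nearMod (D x : Expr) :
    (nearMod D x).eval s = _root_.nearMod (D.eval s) (x.eval s) := rfl

end Expr

open GroupRAM.Expr

/-- The matrix `W`, or its transpose if `b` is false. -/
def orient (b : Bool) (W : ℤ → ℤ → ℤ) : ℤ → ℤ → ℤ := bif b then W else fun i j => W j i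

/-- A cell of array `0`, or of its transpose. -/
def orientCell (b : Bool) (i j : Expr) : Expr := bif b then .cell 0 i j else .cell 0 j i

/-- Write into a cell of array `0`, or of its transpose. -/
def orientStore (b : Bool) (i j e : Expr) : Cmd := bif b then .store 0 i j e else .store 0 j i e

section Orient

variable {G : Type*} (s : State G)

/-- The effect of `orientStore`. -/
def State.setOrient (b : Bool) (i j v : ℤ) : State G :=
  bif b then s.setArr 0 i j v else s.setArr 0 j i v

theorem eval_orientCell (b : Bool) (i j : Expr) :
    (orientCell b i j).eval s = orient b (s.arr 0) (i.eval s) (j.eval s) := by cases b <;> rfl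

theorem orient_setOrient (b : Bool) (i j v : ℤ) :
    orient b ((s.setOrient b i j v).arr 0) =
      fun r c => if r = i ∧ c = j then v else orient b (s.arr 0) r c := by
  cases b
  · funext r c
    simp [orient, State.setOrient, State.setArr, and_comm]
  · funext r c
    simp [orient, State.setOrient, State.setArr]

theorem State.setOrient_var (b : Bool) (i j v : ℤ) : (s.setOrient b i j v).var = s.var := by
  cases b <;> rfl

variable {s} in
theorem State.Agree.setOrient {X A B : List ℕ} {s' : State G} (h : s.Agree X A B s') (hA : 0 ∈ A)
    (b : Bool) (i j v : ℤ) : s.Agree X A B (s'.setOrient b i j v) := by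
  cases b
  · exact h.setArr hA _ _ _
  · exact h.setArr hA _ _ _

variable {s} in
theorem Halts.orientStore [Group G] {β : ℕ} {Q : State G → Prop} {b : Bool} {i j e : Expr}
    (hi : i.weight ≤ 128) (hj : j.weight ≤ 128) (hw : e.weight ≤ 128) (he : |e.eval s| < 2 ^ β)
    (h : Q (s.setOrient b (i.eval s) (j.eval s) (e.eval s))) :
    Halts β (GroupRAM.orientStore b i j e) 1 Q s := by
  cases b
  · exact .store hj hi hw he h
  · exact .store hi hj hw he h

end Orient

theorem lt_two_pow_of_le {z : ℤ} {β : ℕ} (h : z ≤ β) : z < 2 ^ β :=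
  h.trans_lt (by exact_mod_cast Nat.lt_two_pow_self)

/-- The variable that holds the length of the rows, or of the columns if `b` is false. -/
def orientVar (b : Bool) : ℕ := bif b then 1 else 0

theorem orientVar_notMem {b : Bool} {X : List ℕ} (h0 : 0 ∉ X) (h1 : 1 ∉ X) :
    orientVar b ∉ X := by cases b <;> assumption

/-- Program: subtract the multiple `var 13` of row `var 10` from row `var 12`. -/
def elimRowCmd (b : Bool) : Cmd :=
  forLoop 15 (lit 0) (var (orientVar b)) (orientStore b (var 12) (var 15)
    (Expr.nearMod (var 9)
      (orientCell b (var 12) (var 15) - var 13 * orientCell b (var 10) (var 15))))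

/-- Program: swap the rows `var 10` and `var 12`. -/
def swapRowCmd (b : Bool) : Cmd :=
  forLoop 15 (lit 0) (var (orientVar b))
    (.seq (.assign 14 (orientCell b (var 12) (var 15)))
      (.seq (orientStore b (var 12) (var 15) (orientCell b (var 10) (var 15)))
        (orientStore b (var 10) (var 15) (var 14))))

/-- Program: multiply generator `var 10` by generator `var 12` to the power `var 13`. -/
def powCmd : Cmd :=
  .seq (.gstore 1 (lit 0) (.cell 0 (var 12))) (.seq (.assign 14 (var 13))
    (.loop (var 14)
      (.seq (.cond (var 14 % lit 2)
          (.gstore 0 (var 10) (.mul (.cell 0 (var 10)) (.cell 1 (lit 0)))) .skip)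
        (.seq (.gstore 1 (lit 0) (.mul (.cell 1 (lit 0)) (.cell 1 (lit 0))))
          (.assign 14 (var 14 / lit 2))))))

/-- Program: swap the generators `var 10` and `var 12`. -/
def swapGenCmd : Cmd :=
  .seq (.gstore 1 (lit 0) (.cell 0 (var 12)))
    (.seq (.gstore 0 (var 12) (.cell 0 (var 10))) (.gstore 0 (var 10) (.cell 1 (lit 0))))

/-- Program for `elimStep` and, if `b` is true, for `elimGen`. -/
def elimStepCmd (b : Bool) : Cmd :=
  .seq (.assign 13 (Expr.nearQuot (orientCell b (var 12) (var 10))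
      (orientCell b (var 10) (var 10)) % var 9))
    (.seq (bif b then powCmd else .skip)
      (.seq (elimRowCmd b)
        (.cond (orientCell b (var 12) (var 10))
          (.seq (swapRowCmd b) (bif b then swapGenCmd else .skip)) .skip)))

variable {G : Type*} [Group G] {β : ℕ} {s : State G}

theorem abs_nearMod_lt {D : ℤ} (hD : 0 < D) (hDβ : D < 2 ^ β) (x : ℤ) :
    |nearMod D x| < 2 ^ β := by
  have h1 := two_mul_abs_nearMod_le hD.ne' x
  have h2 := abs_nonneg (nearMod D x)
  rw [abs_of_pos hD] at h1
  linarith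

theorem halts_elimRowCmd (b : Bool) {i t : ℤ} (hi : s.var 12 = i) (ht : s.var 10 = t) (hit : i ≠ t)
    (hD : 0 < s.var 9) {H : ℤ} (hH : s.var (orientVar b) = H) (hH0 : 0 ≤ H)
    (hHβ : H ≤ β) {W : ℤ → ℤ → ℤ} (hW : orient b (s.arr 0) = W)
    (hsupp : ∀ r j, W r j ≠ 0 → 0 ≤ j ∧ j < H) :
    Halts β (elimRowCmd b) (β * 3 + 2) (fun s' => s.Agree [15] [0] [] s' ∧
      orient b (s'.arr 0) = fun r j => if r = i then nearMod (s.var 9) (W i j - s.var 13 * W t j)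
        else W r j) s := by
  refine .of_bounded fun hs => ?_
  refine Halts.forLoop (fun J s' => s.Agree [15] [0] [] s' ∧
      orient b (s'.arr 0) = fun r j => if r = i ∧ 0 ≤ j ∧ j < J then
        nearMod (s.var 9) (W i j - s.var 13 * W t j) else W r j) (v := H) hH0 le_rfl
    (lt_two_pow_of_le hHβ) (by omega) (by decide) (by simp [Expr.weight]) rfl ?_ ?_ ?_ ?_ ?_
  · rintro J s' ⟨h1, -⟩
    exact (h1.var _ (orientVar_notMem (by decide) (by decide))).trans hH
  · rintro J s' z ⟨h1, h2⟩
    exact ⟨h1.setVar (by decide) _, h2⟩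
  · refine ⟨.refl s, ?_⟩
    rw [hW]
    funext r j
    rw [if_neg (by omega)]
  · rintro J s' hJ hJ' ⟨h1, h2⟩ hx
    have e1 : s'.var 12 = i := (h1.var _ (by decide)).trans hi
    have e2 : s'.var 10 = t := (h1.var _ (by decide)).trans ht
    have e3 : s'.var 9 = s.var 9 := h1.var _ (by decide)
    have e4 : s'.var 13 = s.var 13 := h1.var _ (by decide)
    have hev : (Expr.nearMod (var 9)
      (orientCell b (var 12) (var 15) - var 13 * orientCell b (var 10) (var 15))).eval s' =
        nearMod (s.var 9) (W i J - s.var 13 * W t J) := by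
      simp only [eval_nearMod, eval_sub, eval_mul, eval_orientCell, eval_var, e1, e2, e3, e4, hx,
        h2]
      rw [if_neg (by omega), if_neg (by omega)]
    refine .orientStore (by decide) (by decide) (by cases b <;> decide) ?_ ?_
    · rw [hev]
      exact abs_nearMod_lt hD ((le_abs_self _).trans_lt (hs.var 9)) _
    · rw [hev]
      simp only [eval_var, e1, hx]
      refine ⟨⟨h1.setOrient (by decide) _ _ _ _, ?_⟩, by rw [State.setOrient_var, hx]⟩
      rw [orient_setOrient, h2]
      funext r j
      by_cases hr : r = i
      · subst hr
        by_cases hj : j = J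
        · subst hj
          simp [hJ]
        · have : j < J + 1 ↔ j < J := by omega
          simp [hj, this]
      · simp [hr]
  · rintro s' ⟨h1, h2⟩
    refine ⟨h1, ?_⟩
    rw [h2]
    funext r j
    by_cases hr : r = i
    · subst hr
      by_cases hj : 0 ≤ j ∧ j < H
      · simp [hj]
      · have h3 : W r j = 0 := by by_contra h; exact hj (hsupp _ _ h)
        have h4 : W t j = 0 := by by_contra h; exact hj (hsupp _ _ h)
        simp [hj, h3, h4]
    · simp [hr]

theorem halts_swapRowCmd (b : Bool) {i t : ℤ} (hi : s.var 12 = i) (ht : s.var 10 = t) (hit : i ≠ t)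
    {H : ℤ} (hH : s.var (orientVar b) = H) (hH0 : 0 ≤ H)
    (hHβ : H ≤ β) {W : ℤ → ℤ → ℤ} (hW : orient b (s.arr 0) = W)
    (hsupp : ∀ r j, W r j ≠ 0 → 0 ≤ j ∧ j < H) :
    Halts β (swapRowCmd b) (β * 5 + 2) (fun s' => s.Agree [14, 15] [0] [] s' ∧
      orient b (s'.arr 0) = fun r => W (Equiv.swap i t r)) s := by
  refine .of_bounded fun hs => ?_
  have hWβ : ∀ r j, |W r j| < 2 ^ β := by
    subst hW
    cases b
    · exact fun r j => hs.arr 0 j r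
    · exact fun r j => hs.arr 0 r j
  refine Halts.forLoop (fun J s' => s.Agree [14, 15] [0] [] s' ∧
      orient b (s'.arr 0) = fun r j => if 0 ≤ j ∧ j < J then W (Equiv.swap i t r) j else W r j)
    (v := H) hH0 le_rfl
    (lt_two_pow_of_le hHβ) (by omega) (by decide) (by simp [Expr.weight]) rfl ?_ ?_ ?_ ?_ ?_
  · rintro J s' ⟨h1, -⟩
    exact (h1.var _ (orientVar_notMem (by decide) (by decide))).trans hH
  · rintro J s' z ⟨h1, h2⟩
    exact ⟨h1.setVar (by decide) _, h2⟩
  · refine ⟨.refl s, ?_⟩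
    rw [hW]
    funext r j
    rw [if_neg (by omega)]
  · rintro J s' hJ hJ' ⟨h1, h2⟩ hx
    have e1 : s'.var 12 = i := (h1.var _ (by decide)).trans hi
    have e2 : s'.var 10 = t := (h1.var _ (by decide)).trans ht
    have hWJ : ∀ r, orient b (s'.arr 0) r J = W r J := by
      intro r
      rw [h2]
      exact if_neg (by omega)
    have ev1 : (orientCell b (var 12) (var 15)).eval s' = W i J := by
      rw [eval_orientCell, eval_var, eval_var, e1, hx, hWJ]
    refine .seq (m := 1) (m' := 2) (.assign (by cases b <;> decide) (by rw [ev1]; exact hWβ _ _) ?_)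
    rw [ev1]
    set s₁ := s'.setVar 14 (W i J) with hs₁
    have a1 : s.Agree [14, 15] [0] [] s₁ := h1.setVar (by decide) _
    have f1 : s₁.var 12 = i := e1
    have f2 : s₁.var 10 = t := e2
    have f3 : s₁.var 15 = J := hx
    have f4 : s₁.var 14 = W i J := rfl
    have f5 : s₁.arr 0 = s'.arr 0 := rfl
    have ev2 : (orientCell b (var 10) (var 15)).eval s₁ = W t J := by
      rw [eval_orientCell, eval_var, eval_var, f2, f3, f5, hWJ]
    refine .seq (m := 1) (m' := 1) (.orientStore (by decide) (by decide) (by cases b <;> decide)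
      (by rw [ev2]; exact hWβ _ _) ?_)
    rw [ev2]
    simp only [eval_var, f1, f3]
    have a2 := a1.setOrient (by decide) b i J (W t J)
    have g1 := s₁.setOrient_var b i J (W t J)
    have g2 := orient_setOrient s₁ b i J (W t J)
    set s₂ := s₁.setOrient b i J (W t J)
    refine .orientStore (by decide) (by decide) (by decide)
      (by rw [eval_var, g1, f4]; exact hWβ _ _) ?_
    simp only [eval_var, g1, f2, f3, f4]
    refine ⟨⟨a2.setOrient (by decide) _ _ _ _, ?_⟩, by rw [State.setOrient_var, g1, f3]⟩
    rw [orient_setOrient, g2, f5, h2]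
    funext r j
    by_cases hj : j = J
    · subst hj
      rcases eq_or_ne r t with rfl | hrt
      · simp [hJ]
      rcases eq_or_ne r i with rfl | hri
      · simp [hJ, hrt]
      · simp [hrt, hri, Equiv.swap_apply_of_ne_of_ne]
    · have : j < J + 1 ↔ j < J := by omega
      simp [hj, this]
  · rintro s' ⟨h1, h2⟩
    refine ⟨h1, ?_⟩
    rw [h2]
    funext r j
    by_cases hj : 0 ≤ j ∧ j < H
    · simp [hj]
    · rw [if_neg hj]
      have h3 : ∀ r, W r j = 0 := fun r => by by_contra h; exact hj (hsupp _ _ h)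
      rw [h3, h3]

theorem halts_powCmd {i t : ℤ} (hi : s.var 12 = i) (ht : s.var 10 = t) (hq : 0 ≤ s.var 13) :
    Halts β powCmd (β * 7 + 5) (fun s' => s.Agree [14] [] [0, 1] s' ∧
      s'.grp 0 = fun r => if r = t then s.grp 0 t * s.grp 0 i ^ s.var 13 else s.grp 0 r) s := by
  refine .of_bounded fun hs => ?_
  have hb : Halts β powCmd (1 + (1 + (β * (4 + 1 + 1) + 1)))
      (fun s' => s.Agree [14] [] [0, 1] s' ∧
        s'.grp 0 = fun r => if r = t then s.grp 0 t * s.grp 0 i ^ s.var 13 else s.grp 0 r) s := by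
    refine .seq (.gstore (by decide) (by decide) ?_)
    refine .seq (.assign (by decide) (hs.var 13) ?_)
    refine Halts.loop (by decide) (fun r s' => s.Agree [14] [] [0, 1] s' ∧ 0 ≤ s'.var 14 ∧
      s'.var 14 < 2 ^ r ∧ (∀ x, x ≠ t → s'.grp 0 x = s.grp 0 x) ∧
      s'.grp 0 t * s'.grp 1 0 ^ s'.var 14 = s.grp 0 t * s.grp 0 i ^ s.var 13) ?_ ?_ β _ ?_
    · rintro r s' ⟨h1, h2, h3, h4, h5⟩ he
      rw [eval_var] at he
      refine ⟨h1, ?_⟩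
      funext x
      rw [he, zpow_zero, mul_one] at h5
      split_ifs with hx
      · rw [hx, h5]
      · exact h4 x hx
    · rintro r s' ⟨h1, h2, h3, h4, h5⟩ he
      rw [eval_var] at he
      have hr : r ≠ 0 := by
        rintro rfl
        rw [pow_zero] at h3
        omega
      obtain ⟨r, rfl⟩ := Nat.exists_eq_succ_of_ne_zero hr
      refine ⟨r, rfl, .of_bounded fun hs' => ?_⟩
      have e2 : s'.var 10 = t := (h1.var _ (by decide)).trans ht
      have hdiv : s'.var 14 = s'.var 14 % 2 + 2 * (s'.var 14 / 2) :=
        (Int.emod_add_mul_ediv _ 2).symm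
      have hmid : Halts β (.cond (var 14 % lit 2)
          (.gstore 0 (var 10) (.mul (.cell 0 (var 10)) (.cell 1 (lit 0)))) .skip) 2
          (fun s'' => s.Agree [14] [] [0, 1] s'' ∧ s''.var 14 = s'.var 14 ∧
            s''.grp 1 0 = s'.grp 1 0 ∧ (∀ x, x ≠ t → s''.grp 0 x = s.grp 0 x) ∧
            s''.grp 0 t = s'.grp 0 t * s'.grp 1 0 ^ (s'.var 14 % 2)) s' := by
        refine .cond (by decide) (fun h => .gstore (by decide) (by decide) ?_)
          fun h => .skip ?_
        · have h6 : s'.var 14 % 2 = 1 := by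
            simp only [eval_mod, eval_var, eval_lit] at h
            omega
          refine ⟨h1.setGrp (by decide) _ _, rfl, rfl, fun x hx => ?_, ?_⟩
          · rw [← h4 x hx]
            simp [State.setGrp, eval_var, e2, hx]
          · simp [State.setGrp, eval_var, eval_lit, e2, GExpr.eval, h6]
        · have h6 : s'.var 14 % 2 = 0 := h
          exact ⟨h1, rfl, rfl, h4, by simp [h6]⟩
      refine Halts.mono (m := 2 + (1 + 1)) (.seq (hmid.imp ?_)) (by omega) fun _ _ h => h
      rintro s₁ ⟨b1, b2, b3, b4, b5⟩
      refine .seq (.gstore (by decide) (by decide) ?_)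
      simp only [eval_lit, GExpr.eval]
      have c1 : ∀ g : G, (s₁.setGrp 1 0 g).grp 0 = s₁.grp 0 := fun g => by
        funext x; simp [State.setGrp]
      have c2 : ∀ g : G, (s₁.setGrp 1 0 g).grp 1 0 = g := fun g => by simp [State.setGrp]
      have hlt : s'.var 14 / 2 < 2 ^ r := by rw [pow_succ] at h3; omega
      have hev : (var 14 / lit 2).eval (s₁.setGrp 1 0 (s₁.grp 1 0 * s₁.grp 1 0)) =
          s'.var 14 / 2 := by
        rw [eval_div, eval_var, eval_lit, ← b2]; rfl
      refine .assign (by decide) ?_ ?_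
      · rw [hev, abs_of_nonneg (by omega)]
        have := (le_abs_self _).trans_lt (hs'.var 14)
        omega
      · rw [hev]
        refine ⟨(b1.setGrp (by decide) _ _).setVar (by decide) _, ?_, ?_, fun x hx => ?_, ?_⟩
        · simp only [State.setVar, if_true]; omega
        · simpa only [State.setVar, if_true] using hlt
        · exact (congrFun (c1 (s₁.grp 1 0 * s₁.grp 1 0)) x).trans (b4 x hx)
        · rw [← h5]
          simp only [State.setVar, if_true, c1, c2, b3, b5]
          conv_rhs => rw [hdiv, zpow_add, zpow_mul, ← mul_assoc]
          congr 2
          rw [zpow_two]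
    · have c1 : ∀ g : G, (s.setGrp 1 0 g).grp 0 = s.grp 0 := fun g => by
        funext x; simp [State.setGrp]
      have c2 : ∀ g : G, (s.setGrp 1 0 g).grp 1 0 = g := fun g => by simp [State.setGrp]
      refine ⟨((State.Agree.refl s).setGrp (by decide) _ _).setVar (by decide) _, ?_, ?_, ?_, ?_⟩
      · simpa [State.setVar, eval_var, State.setGrp] using hq
      · simpa [State.setVar, eval_var, State.setGrp] using (le_abs_self _).trans_lt (hs.var 13)
      · intro x _
        simp only [State.setVar, eval_lit, c1]
      · simp [State.setVar, State.setGrp, GExpr.eval, eval_lit, eval_var, hi]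
  exact hb.mono (by omega) fun _ _ h => h

theorem halts_swapGenCmd {i t : ℤ} (hi : s.var 12 = i) (ht : s.var 10 = t) :
    Halts β swapGenCmd 3 (fun s' => s.Agree [] [] [0, 1] s' ∧
      s'.grp 0 = fun r => s.grp 0 (Equiv.swap i t r)) s := by
  refine .seq (m := 1) (m' := 2) (.gstore (by decide) (by decide) ?_)
  refine .seq (m := 1) (m' := 1) (.gstore (by decide) (by decide) ?_)
  refine .gstore (by decide) (by decide) ?_
  refine ⟨(((State.Agree.refl s).setGrp (by decide) _ _).setGrp (by decide) _ _).setGrp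
    (by decide) _ _, ?_⟩
  funext r
  rcases eq_or_ne r t with rfl | hrt
  · simp [State.setGrp, eval_var, eval_lit, GExpr.eval, hi, ht]
  rcases eq_or_ne r i with rfl | hri
  · simp [State.setGrp, eval_var, eval_lit, GExpr.eval, hi, ht, hrt]
  · simp [State.setGrp, eval_var, eval_lit, GExpr.eval, hi, ht, hrt, hri,
      Equiv.swap_apply_of_ne_of_ne]

theorem halts_elimStepCmd (b : Bool) {i t D : ℤ} (hi : s.var 12 = i) (ht : s.var 10 = t)
    (hit : i ≠ t) (hDs : s.var 9 = D) (hD : 0 < D) {H : ℤ} (hH : s.var (orientVar b) = H)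
    (hH0 : 0 ≤ H) (hHβ : H ≤ β) {W : ℤ → ℤ → ℤ} (hW : orient b (s.arr 0) = W)
    (hsupp : ∀ r j, W r j ≠ 0 → 0 ≤ j ∧ j < H) :
    Halts β (elimStepCmd b) (β * 15 + 15) (fun s' => s.Agree [13, 14, 15] [0] [0, 1] s' ∧
      orient b (s'.arr 0) = elimStep D t i W ∧
      s'.grp 0 = bif b then elimGen D t i W (s.grp 0) else s.grp 0) s := by
  refine .of_bounded fun hs => ?_
  refine Halts.mono (m := 1 + ((β * 7 + 5) + ((β * 3 + 2) + ((β * 5 + 2 + 3) + 1)))) ?_ (by omega)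
    fun _ _ h => h
  have hq0 : 0 ≤ elimQuot D t i W := Int.emod_nonneg _ hD.ne'
  have hqD : elimQuot D t i W < D := Int.emod_lt_of_pos _ hD
  have hDβ : D < 2 ^ β := hDs ▸ (le_abs_self _).trans_lt (hs.var 9)
  have hev : (Expr.nearQuot (orientCell b (var 12) (var 10)) (orientCell b (var 10) (var 10)) %
      var 9).eval s = elimQuot D t i W := by
    simp only [eval_mod, eval_nearQuot, eval_orientCell, eval_var, hi, ht, hDs, hW, elimQuot]
  refine .seq (.assign (by cases b <;> decide) (by rw [hev, abs_of_nonneg hq0]; omega) ?_)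
  rw [hev]
  set q := elimQuot D t i W with hq
  have a1 : s.Agree [13, 14, 15] [0] [0, 1] (s.setVar 13 q) :=
    (State.Agree.refl s).setVar (by decide) _
  have f13 : (s.setVar 13 q).var 13 = q := rfl
  have f12 : (s.setVar 13 q).var 12 = i := hi
  have f10 : (s.setVar 13 q).var 10 = t := ht
  have farr : (s.setVar 13 q).arr = s.arr := rfl
  have fgrp : (s.setVar 13 q).grp = s.grp := rfl
  generalize s.setVar 13 q = s₁ at a1 f13 f12 f10 farr fgrp
  have hpow : Halts β (bif b then powCmd else .skip) (β * 7 + 5)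
      (fun s₂ => s₁.Agree [14] [] [0, 1] s₂ ∧
        s₂.grp 0 = bif b then fun r => if r = t then s.grp 0 t * s.grp 0 i ^ q else s.grp 0 r
          else s.grp 0) s₁ := by
    cases b
    · exact (Halts.skip ⟨.refl _, by rw [fgrp]; rfl⟩ : Halts β .skip 1 _ s₁).mono (by omega)
        fun _ _ h => h
    · refine (halts_powCmd f12 f10 (by rw [f13]; exact hq0)).imp ?_
      rintro s₂ ⟨h1, h2⟩
      exact ⟨h1, by rw [h2, fgrp, f13]; rfl⟩
  refine .seq (hpow.imp ?_)
  rintro s₂ ⟨a2, hg2⟩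
  have a2' := a1.trans a2 (by decide) (by decide) (by decide)
  have e9 : s₂.var 9 = D := (a2'.var _ (by decide)).trans hDs
  have e10 : s₂.var 10 = t := (a2'.var _ (by decide)).trans ht
  have e12 : s₂.var 12 = i := (a2'.var _ (by decide)).trans hi
  have e13 : s₂.var 13 = q := (a2.var _ (by decide)).trans f13
  have eH : s₂.var (orientVar b) = H :=
    (a2'.var _ (orientVar_notMem (by decide) (by decide))).trans hH
  have earr : s₂.arr 0 = s.arr 0 := (a2.arr _ (by decide)).trans (by rw [farr])
  refine .seq ((halts_elimRowCmd b e12 e10 hit (e9 ▸ hD) eH hH0 hHβ (earr ▸ hW) hsupp).imp ?_)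
  rintro s₃ ⟨a3, hW3⟩
  rw [e9, e13] at hW3
  have a3' := a2'.trans a3 (by decide) (by decide) (by decide)
  change orient b (s₃.arr 0) = elimRow D t i W at hW3
  have e10 : s₃.var 10 = t := (a3'.var _ (by decide)).trans ht
  have e12 : s₃.var 12 = i := (a3'.var _ (by decide)).trans hi
  have eH : s₃.var (orientVar b) = H :=
    (a3'.var _ (orientVar_notMem (by decide) (by decide))).trans hH
  have hg3 : s₃.grp 0 = s₂.grp 0 := a3.grp _ (by decide)
  have hcond : (orientCell b (var 12) (var 10)).eval s₃ = elimRow D t i W i t := by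
    rw [eval_orientCell, eval_var, eval_var, e10, e12, hW3]
  have hsupp3 : ∀ r j, elimRow D t i W r j ≠ 0 → 0 ≤ j ∧ j < H := by
    intro r j hrj
    by_contra hj
    have h3 : ∀ r, W r j = 0 := fun r => by by_contra h; exact hj (hsupp _ _ h)
    refine hrj ?_
    simp [elimRow, h3]
  refine .cond (by cases b <;> decide) (fun h => ?_) fun h => ?_
  · rw [hcond] at h
    refine .seq (m := β * 5 + 2) (m' := 3)
      ((halts_swapRowCmd b e12 e10 hit eH hH0 hHβ hW3 hsupp3).imp ?_)
    rintro s₄ ⟨a4, hW4⟩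
    have a4' := a3'.trans a4 (by decide) (by decide) (by decide)
    have e10 : s₄.var 10 = t := (a4'.var _ (by decide)).trans ht
    have e12 : s₄.var 12 = i := (a4'.var _ (by decide)).trans hi
    have hg4 : s₄.grp 0 = s₂.grp 0 := (a4.grp _ (by decide)).trans hg3
    have hW4' : orient b (s₄.arr 0) = elimStep D t i W := by
      rw [hW4, elimStep, if_neg h]
    cases b
    · exact (Halts.skip ⟨a4', hW4', by rw [hg4, hg2]; rfl⟩ : Halts β .skip 1 _ s₄).mono (by omega)
        fun _ _ h => h
    · refine (halts_swapGenCmd e12 e10).imp ?_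
      rintro s₅ ⟨a5, hg5⟩
      refine ⟨a4'.trans a5 (by decide) (by decide) (by decide), ?_, ?_⟩
      · rw [a5.arr 0 (by decide)]; exact hW4'
      · rw [hg5, hg4, hg2, elimGen, if_neg h]
        rfl
  · rw [hcond] at h
    refine (Halts.skip ⟨a3', ?_, ?_⟩ : Halts β .skip 1 _ s₃).mono (by omega) fun _ _ h => h
    · rw [hW3, elimStep, if_pos h]
    · rw [hg3, hg2]
      cases b
      · rfl
      · simp only [elimGen, if_pos h]
        rfl

end GroupRAM

/-- What a sweep over the rows `R` and the columns `C` has achieved so far, starting from `W₀`: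
the pivot has been replaced by a smaller one, or it is unchanged and the entries have been
cleared. -/
def SweepInv (D t : ℤ) (R C : ℤ → Prop) (W₀ W : ℤ → ℤ → ℤ) : Prop :=
  (¬ Cleared t W₀ ∧ W t t ≠ 0 ∧ |W t t| ≤ D ∧ (W₀ t t = 0 ∨ 2 * |W t t| ≤ |W₀ t t|)) ∨
  (W t t = W₀ t t ∧ (Cleared t W₀ → Cleared t W) ∧ (∀ r, t < r → R r → W r t = 0) ∧
    ∀ c, t < c → C c → W t c = 0)

theorem SweepInv.transpose {D t : ℤ} {R C : ℤ → Prop} {W₀ W : ℤ → ℤ → ℤ}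
    (h : SweepInv D t R C W₀ W) : SweepInv D t C R (fun i j => W₀ j i) fun i j => W j i := by
  rcases h with ⟨h1, h2⟩ | ⟨h1, h2, h3, h4⟩
  · exact Or.inl ⟨fun h => h1 h.transpose, h2⟩
  · exact Or.inr ⟨h1, fun h => (h2 h.transpose).transpose, h4, h3⟩

theorem SweepInv.elimStep {D t i : ℤ} {R R' C : ℤ → Prop} {W₀ W : ℤ → ℤ → ℤ} (hD : 0 < D)
    (hi : t < i) (h : SweepInv D t R C W₀ W) (hR : ∀ r, R' r → R r ∨ r = i) :
    SweepInv D t R' C W₀ (elimStep D t i W) := by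
  rcases elimStep_pivot hD hi W with ⟨e1, e2, e3, e4⟩ | ⟨e1, e2, e3⟩
  · refine Or.inl ?_
    rcases h with ⟨h1, h2, h3, h4⟩ | ⟨h1, h2, -⟩
    · refine ⟨h1, e2, e3, h4.imp_right fun h4 => ?_⟩
      have := e4.resolve_left h2
      have := abs_nonneg (W t t)
      linarith
    · exact ⟨fun h => e1 (h2 h), e2, e3, h1 ▸ e4⟩
  · have hp : _root_.elimStep D t i W t t = W t t := by rw [e1]
    rcases h with h | ⟨h1, h2, h3, h4⟩
    · exact Or.inl (by rwa [hp])
    · refine Or.inr ⟨by rw [hp, h1], fun h r hr => ⟨?_, ?_⟩, fun r hr hRr => ?_, fun c hc hCc => ?_⟩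
      · by_cases hri : r = i
        · rw [hri, e2]
        · rw [e3 r hri, (h2 h r hr).1]
      · rw [e1, (h2 h r hr).2]
      · by_cases hri : r = i
        · rw [hri, e2]
        · rw [e3 r hri, h3 r hr ((hR r hRr).resolve_right hri)]
      · rw [e1, h4 c hc hCc]

theorem SweepInv.refl {D t : ℤ} {R C : ℤ → Prop} {W : ℤ → ℤ → ℤ} (hR : ∀ r, t < r → ¬ R r)
    (hC : ∀ r, t < r → ¬ C r) : SweepInv D t R C W W :=
  Or.inr ⟨rfl, id, fun r h h' => absurd h' (hR r h), fun r h h' => absurd h' (hC r h)⟩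

theorem Cleared.of_supported {k n t : ℤ} {W : ℤ → ℤ → ℤ} (hW : Supported k n W)
    (h1 : ∀ r, t < r → r < k → W r t = 0) (h2 : ∀ c, t < c → c < n → W t c = 0) :
    Cleared t W := by
  intro r hr
  constructor
  · by_contra h
    exact h (h1 r hr (hW _ _ h).1.2)
  · by_contra h
    exact h (h2 r hr (hW _ _ h).2.2)

theorem DiagUpTo.succ {t : ℤ} {W : ℤ → ℤ → ℤ} (h : DiagUpTo t W) (hc : Cleared t W) :
    DiagUpTo (t + 1) W := by
  intro i j hij ht
  by_cases h1 : i < t ∨ j < t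
  · exact h i j hij h1
  · rcases eq_or_ne i t with rfl | hi
    · exact (hc j (by omega)).2
    · obtain rfl : j = t := by omega
      exact (hc i (by omega)).1

namespace GroupRAM

open GroupRAM.Expr

variable {G : Type*} [CommGroup G] {β : ℕ} {s : State G}

/-- The memory during the elimination, when the first `t` rows and columns are done. -/
structure Reducing (k n D t : ℤ) (s : State G) : Prop where
  var0 : s.var 0 = k
  var1 : s.var 1 = n
  var9 : s.var 9 = D
  supp : Supported k n (s.arr 0)
  diag : DiagUpTo t (s.arr 0)
  pres : Presents k n D (s.arr 0) (s.grp 0)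

theorem Reducing.agree {k n D t : ℤ} {s s' : State G} (h : Reducing k n D t s)
    {X A B : List ℕ} (ha : s.Agree X A B s') (h0 : 0 ∉ X := by decide) (h1 : 1 ∉ X := by decide)
    (h9 : 9 ∉ X := by decide) (hA : 0 ∉ A := by decide) (hB : 0 ∉ B := by decide) :
    Reducing k n D t s' where
  var0 := (ha.var _ h0).trans h.var0
  var1 := (ha.var _ h1).trans h.var1
  var9 := (ha.var _ h9).trans h.var9
  supp := by rw [ha.arr _ hA]; exact h.supp
  diag := by rw [ha.arr _ hA]; exact h.diag
  pres := by rw [ha.arr _ hA, ha.grp _ hB]; exact h.pres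

theorem Reducing.elimStepCmd {k n D t i : ℤ} (h : Reducing k n D t s) (hk : k ≤ β) (hn : n ≤ β)
    (hD : 0 < D) (ht0 : 0 ≤ t) (htk : t < k) (htn : t < n) (h10 : s.var 10 = t)
    (h12 : s.var 12 = i) (hti : t < i) (b : Bool) (hi : i < bif b then k else n) :
    Halts β (elimStepCmd b) (β * 15 + 15) (fun s' => Reducing k n D t s' ∧
      s.Agree [13, 14, 15] [0] [0, 1] s' ∧
      orient b (s'.arr 0) = elimStep D t i (orient b (s.arr 0))) s := by
  cases b
  · refine (halts_elimStepCmd false h12 h10 hti.ne' h.var9 hD (H := k) h.var0 (by omega) hk rfl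
      fun r j hrj => (h.supp _ _ hrj).1).imp ?_
    rintro s' ⟨h1, h2, h3⟩
    have h4 : s'.arr 0 = fun r j => elimStep D t i (fun r j => s.arr 0 j r) j r := by
      funext r j
      exact congrFun (congrFun h2 j) r
    refine ⟨⟨(h1.var _ (by decide)).trans h.var0, (h1.var _ (by decide)).trans h.var1,
      (h1.var _ (by decide)).trans h.var9, ?_, ?_, ?_⟩, h1, h2⟩
    · rw [h4]
      exact (h.supp.transpose.elimStep ht0 hti hi).transpose
    · rw [h4]
      exact (h.diag.transpose.elimStep hti).transpose
    · rw [h4, h3]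
      exact h.pres.elimStep_transpose (Finset.mem_Ico.2 ⟨ht0, htn⟩)
        (Finset.mem_Ico.2 ⟨by omega, hi⟩) hti.ne
  · refine (halts_elimStepCmd true h12 h10 hti.ne' h.var9 hD (H := n) h.var1 (by omega) hn rfl
      fun r j hrj => (h.supp _ _ hrj).2).imp ?_
    rintro s' ⟨h1, h2, h3⟩
    have h4 : s'.arr 0 = elimStep D t i (s.arr 0) := h2
    refine ⟨⟨(h1.var _ (by decide)).trans h.var0, (h1.var _ (by decide)).trans h.var1,
      (h1.var _ (by decide)).trans h.var9, ?_, ?_, ?_⟩, h1, h2⟩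
    · rw [h4]
      exact h.supp.elimStep ht0 hti hi
    · rw [h4]
      exact h.diag.elimStep hti
    · rw [h4, h3]
      exact h.pres.elimStep (Finset.mem_Ico.2 ⟨ht0, htk⟩)
        (Finset.mem_Ico.2 ⟨by omega, hi⟩) hti.ne

/-- Program: apply `elimStepCmd` to row `var 10` and all later rows. -/
def elimLoopCmd (b : Bool) : Cmd :=
  forLoop 12 (var 10 + lit 1) (var (orientVar !b)) (elimStepCmd b)

theorem Reducing.elimLoopCmd {k n D t : ℤ} (h : Reducing k n D t s) (hk : k ≤ β) (hn : n ≤ β)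
    (hD : 0 < D) (ht0 : 0 ≤ t) (htk : t < k) (htn : t < n) (h10 : s.var 10 = t) (b : Bool)
    (W₀ : ℤ → ℤ → ℤ) (C : ℤ → Prop)
    (hW : SweepInv D t (fun r => r < t + 1) C (orient b W₀) (orient b (s.arr 0))) :
    Halts β (elimLoopCmd b) (β * (β * 15 + 15 + 2) + 2) (fun s' => Reducing k n D t s' ∧
      s.Agree [12, 13, 14, 15] [0] [0, 1] s' ∧
      SweepInv D t (fun r => r < bif b then k else n) C (orient b W₀) (orient b (s'.arr 0))) s := by
  have hb : t + 1 ≤ bif b then k else n := by cases b <;> simp <;> omega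
  have hb' : (bif b then k else n) ≤ β := by cases b <;> assumption
  refine Halts.forLoop (fun i s' => Reducing k n D t s' ∧
      s.Agree [12, 13, 14, 15] [0] [0, 1] s' ∧
      SweepInv D t (fun r => r < i) C (orient b W₀) (orient b (s'.arr 0)))
    hb (by omega) (lt_two_pow_of_le hb') (by omega) (by decide) (by simp [Expr.weight])
    (by rw [eval_add, eval_var, eval_lit, h10]) ?_ ?_ ⟨h, .refl s, hW⟩ ?_ fun _ h => h
  · rintro i s' ⟨h1, -⟩
    cases b
    · exact h1.var1
    · exact h1.var0
  · rintro i s' z ⟨h1, h2, h3⟩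
    exact ⟨h1.agree ((State.Agree.refl s').setVar (X := [12]) (A := []) (B := []) (by decide) z),
      h2.setVar (by decide) _, h3⟩
  · rintro i s' hi hi' ⟨h1, h2, h3⟩ hx
    refine (h1.elimStepCmd hk hn hD ht0 htk htn ((h2.var _ (by decide)).trans h10) hx
      (by omega) b hi').imp ?_
    rintro s'' ⟨h4, h5, h6⟩
    refine ⟨⟨h4, h2.trans h5 (by decide) (by decide) (by decide), ?_⟩,
      (h5.var _ (by decide)).trans hx⟩
    rw [h6]
    exact h3.elimStep hD (by omega) fun r hr => by omega

/-- Program: clear row and column `var 10`. -/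
def phaseCmd : Cmd :=
  .seq (.assign 11 (lit 2 * var 9)) (.loop (var 11)
    (.seq (elimLoopCmd true) (.seq (elimLoopCmd false) (.assign 11 (var 11 / lit 2)))))

/-- A bound for the number of steps of `phaseCmd`. -/
def phaseSteps (β : ℕ) : ℕ :=
  1 + (β * (β * (β * 15 + 15 + 2) + 2 + (β * (β * 15 + 15 + 2) + 2 + 1) + 1) + 1)

theorem Reducing.phaseCmd {k n D t : ℤ} (h : Reducing k n D t s) (hk : k ≤ β) (hn : n ≤ β)
    (hD : 0 < D) (hDβ : 2 * D < 2 ^ β) (ht0 : 0 ≤ t) (htk : t < k) (htn : t < n)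
    (h10 : s.var 10 = t) :
    Halts β phaseCmd (phaseSteps β) (fun s' => Reducing k n D (t + 1) s' ∧ s'.var 10 = t) s := by
  have hev : (lit 2 * var 9).eval s = 2 * D := by rw [eval_mul, eval_lit, eval_var, h.var9]
  refine .seq (.assign (by decide) (by rw [hev, abs_of_pos (by omega)]; exact hDβ) ?_)
  rw [hev]
  refine Halts.loop (by decide) (fun r s' => Reducing k n D t s' ∧ s'.var 10 = t ∧
    0 ≤ s'.var 11 ∧ s'.var 11 < 2 ^ r ∧ (Cleared t (s'.arr 0) ∨
      (s'.arr 0 t t ≠ 0 ∧ |s'.arr 0 t t| ≤ s'.var 11) ∨ 2 * D ≤ s'.var 11)) ?_ ?_ β _ ?_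
  · rintro r s' ⟨h1, h2, h3, h4, h5⟩ he
    rw [eval_var] at he
    rw [he] at h5
    have hc : Cleared t (s'.arr 0) := by
      rcases h5 with h5 | ⟨h5, h6⟩ | h5
      · exact h5
      · exact absurd (abs_nonpos_iff.1 h6) h5
      · omega
    exact ⟨⟨h1.var0, h1.var1, h1.var9, h1.supp, h1.diag.succ hc, h1.pres⟩, h2⟩
  · rintro r s' ⟨h1, h2, h3, h4, h5⟩ he
    rw [eval_var] at he
    have hr : r ≠ 0 := by
      rintro rfl
      rw [pow_zero] at h4
      omega
    obtain ⟨r, rfl⟩ := Nat.exists_eq_succ_of_ne_zero hr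
    refine ⟨r, rfl, .of_bounded fun hs' => ?_⟩
    refine .seq ((h1.elimLoopCmd hk hn hD ht0 htk htn h2 true (s'.arr 0) (fun c => c < t + 1)
      (SweepInv.refl (fun r hr => by omega) fun r hr => by omega)).imp ?_)
    rintro s₁ ⟨r1, a1, i1⟩
    refine .seq ((r1.elimLoopCmd hk hn hD ht0 htk htn ((a1.var _ (by decide)).trans h2) false
      (s'.arr 0) (fun c => c < k) (SweepInv.transpose i1)).imp ?_)
    rintro s₂ ⟨r2, a2, i2⟩
    have i3 := i2.transpose
    change SweepInv D t (fun r => r < k) (fun c => c < n) (s'.arr 0) (s₂.arr 0) at i3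
    have f10 : s₂.var 10 = t := (a2.var _ (by decide)).trans ((a1.var _ (by decide)).trans h2)
    have f11 : s₂.var 11 = s'.var 11 := (a2.var _ (by decide)).trans (a1.var _ (by decide))
    have hev : (var 11 / lit 2).eval s₂ = s'.var 11 / 2 := by
      rw [eval_div, eval_var, eval_lit, f11]
    have hlt : s'.var 11 / 2 < 2 ^ r := by rw [pow_succ] at h4; omega
    refine .assign (by decide) ?_ ?_
    · rw [hev, abs_of_nonneg (by omega)]
      have := (le_abs_self _).trans_lt (hs'.var 11)
      omega
    · rw [hev]
      refine ⟨r2.agree ((State.Agree.refl s₂).setVar (X := [11]) (A := []) (B := []) (by decide) _),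
        f10, ?_, ?_, ?_⟩
      · simp only [State.setVar, if_true]; omega
      · simpa only [State.setVar, if_true] using hlt
      · simp only [State.setVar, if_true]
        rcases i3 with ⟨j1, j2, j3, j4⟩ | ⟨j1, j2, j3, j4⟩
        · refine Or.inr (Or.inl ⟨j2, ?_⟩)
          rcases h5 with h5 | ⟨h5, h6⟩ | h5
          · exact absurd h5 j1
          · have := j4.resolve_left h5
            omega
          · omega
        · exact Or.inl (Cleared.of_supported r2.supp j3 j4)
  · refine ⟨h.agree ((State.Agree.refl s).setVar (X := [11]) (A := []) (B := []) (by decide) _),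
      h10, ?_, ?_, ?_⟩
    · simp only [State.setVar, if_true]; omega
    · simpa only [State.setVar, if_true] using hDβ
    · simp [State.setVar]

/-- Program: diagonalize the matrix. -/
def diagonalizeCmd : Cmd := forLoop 10 (lit 0) (var 0) phaseCmd

theorem Reducing.diagonalizeCmd {k n D : ℤ} (h : Reducing k n D 0 s) (hk0 : 0 ≤ k) (hkn : k ≤ n)
    (hn : n ≤ β) (hD : 0 < D) (hDβ : 2 * D < 2 ^ β) :
    Halts β diagonalizeCmd (β * (phaseSteps β + 2) + 2) (Reducing k n D k) s := by
  refine Halts.forLoop (fun t s' => Reducing k n D t s') hk0 le_rfl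
    (lt_two_pow_of_le (hkn.trans hn)) (by omega) (by decide) (by decide) rfl
    (fun t s' h => h.var0) (fun t s' z h => ?_) h ?_ fun _ h => h
  · exact h.agree ((State.Agree.refl s').setVar (X := [10]) (A := []) (B := []) (by decide) _)
  · intro t s' ht0 htk h1 h10
    exact h1.phaseCmd (hkn.trans hn) hn hD hDβ ht0 htk (by omega) h10


variable {G : Type*} [Group G] {β : ℕ} {s : State G}

/-- Program: put the sum of the values of `e` for `var 4 = 0, …, hi - 1` into `var 5`. -/
def sumCmd (hi e : Expr) : Cmd :=
  .seq (.assign 5 (lit 0)) (forLoop 4 (lit 0) hi (.assign 5 (var 5 + e)))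

theorem halts_sumCmd {hi e : Expr} (hwhi : hi.weight ≤ 100) (hwe : e.weight ≤ 100) {H : ℤ}
    (hH0 : 0 ≤ H) (hHβ : H ≤ β) {f : ℤ → ℤ} (hhi : ∀ s', s.Agree [4, 5] [] [] s' → hi.eval s' = H)
    (he : ∀ s' r, s.Agree [4, 5] [] [] s' → 0 ≤ r → r < H → s'.var 4 = r → e.eval s' = f r)
    (hf : ∀ r, 0 ≤ r → r ≤ H → |∑ j ∈ Finset.Ico 0 r, f j| < 2 ^ β) :
    Halts β (sumCmd hi e) (1 + (β * 3 + 2)) (fun s' => s.Agree [4, 5] [] [] s' ∧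
      s'.var 5 = ∑ j ∈ Finset.Ico 0 H, f j) s := by
  refine .seq (.assign (by decide) (by simp [eval_lit]) ?_)
  refine Halts.forLoop (fun r s' => s.Agree [4, 5] [] [] s' ∧
    s'.var 5 = ∑ j ∈ Finset.Ico 0 r, f j) hH0 le_rfl (lt_two_pow_of_le hHβ) (by omega)
    (by decide) hwhi rfl (fun r s' h => hhi s' h.1) ?_ ?_ ?_ fun _ h => h
  · rintro r s' z ⟨h1, h2⟩
    exact ⟨h1.setVar (by decide) _, h2⟩
  · exact ⟨(State.Agree.refl s).setVar (by decide) _, by simp [State.setVar, eval_lit]⟩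
  · rintro r s' hr hr' ⟨h1, h2⟩ hx
    have hev : (var 5 + e).eval s' = ∑ j ∈ Finset.Ico 0 (r + 1), f j := by
      rw [eval_add, eval_var, h2, he s' r h1 hr hr' hx, sum_Ico_int_succ hr]
    refine .assign (e := var 5 + e) ?_ (by rw [hev]; exact hf _ (by omega) (by omega)) ?_
    · change 1 + e.weight + 1 ≤ 128
      omega
    · rw [hev]
      exact ⟨⟨h1.setVar (by decide) _, by simp [State.setVar]⟩, hx⟩

/-- Program: put the matrix of the scalar products of the rows of array `0` into array `1`. -/
def gramCmd : Cmd :=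
  forLoop 2 (lit 0) (var 0) (forLoop 3 (lit 0) (var 0)
    (.seq (sumCmd (var 1) (.cell 0 (var 2) (var 4) * .cell 0 (var 3) (var 4)))
      (.store 1 (var 2) (var 3) (var 5))))

/-- The number of steps of a program that computes a sum for every entry of a matrix. -/
def sumsSteps (β : ℕ) : ℕ := β * (β * (1 + (β * 3 + 2) + 1 + 2) + 2 + 2) + 2

theorem halts_gramCmd {k n : ℤ} (h0 : s.var 0 = k) (h1 : s.var 1 = n) (hk : 0 ≤ k) (hn : 0 ≤ n)
    (hkβ : k ≤ β) (hnβ : n ≤ β) (hW : ∀ u v r, 0 ≤ r → r ≤ n →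
      |∑ j ∈ Finset.Ico 0 r, s.arr 0 u j * s.arr 0 v j| < 2 ^ β) :
    Halts β gramCmd (sumsSteps β) (fun s' => s.Agree [2, 3, 4, 5] [1] [] s' ∧
      ∀ u v, 0 ≤ u → u < k → 0 ≤ v → v < k →
        s'.arr 1 u v = ∑ j ∈ Finset.Ico 0 n, s.arr 0 u j * s.arr 0 v j) s := by
  refine Halts.forLoop (fun i s' => s.Agree [2, 3, 4, 5] [1] [] s' ∧
      ∀ u v, 0 ≤ u → u < i → 0 ≤ v → v < k →
        s'.arr 1 u v = ∑ j ∈ Finset.Ico 0 n, s.arr 0 u j * s.arr 0 v j) hk le_rfl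
    (lt_two_pow_of_le hkβ) (by omega) (by decide) (by decide) rfl
    (fun i s' h => (h.1.var _ (by decide)).trans h0)
    (fun i s' z h => ⟨h.1.setVar (by decide) _, h.2⟩)
    ⟨.refl s, fun u v hu hu' => by omega⟩ ?_ fun _ h => h
  rintro i s₁ hi hi' ⟨a1, e1⟩ hx
  refine Halts.forLoop (fun j s' => s₁.Agree [3, 4, 5] [1] [] s' ∧
      ∀ u v, 0 ≤ u → 0 ≤ v → v < k → (u < i ∨ u = i ∧ v < j) →
        s'.arr 1 u v = ∑ j ∈ Finset.Ico 0 n, s.arr 0 u j * s.arr 0 v j) hk le_rfl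
    (lt_two_pow_of_le hkβ) (by omega) (by decide) (by decide) rfl
    (fun j s' h => (h.1.var _ (by decide)).trans ((a1.var _ (by decide)).trans h0))
    (fun j s' z h => ⟨h.1.setVar (by decide) _, h.2⟩)
    ⟨.refl s₁, fun u v hu hv hv' h => e1 u v hu (by omega) hv hv'⟩ ?_ ?_
  · rintro j s₂ hj hj' ⟨a2, e2⟩ hy
    have a3 : s.Agree [2, 3, 4, 5] [1] [] s₂ := a1.trans a2 (by decide) (by decide) (by decide)
    have f2 : s₂.var 2 = i := (a2.var _ (by decide)).trans hx
    refine .seq ((halts_sumCmd (by decide) (by decide) hn hnβ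
      (f := fun r => s.arr 0 i r * s.arr 0 j r) ?_ ?_ ?_).imp ?_)
    · intro s' a
      exact (a.var _ (by decide)).trans ((a3.var _ (by decide)).trans h1)
    · intro s' r a _ _ h
      have g1 : s'.arr 0 = s.arr 0 := (a.arr _ (by decide)).trans (a3.arr _ (by decide))
      have g2 : s'.var 2 = i := (a.var _ (by decide)).trans f2
      have g3 : s'.var 3 = j := (a.var _ (by decide)).trans hy
      simp only [eval_mul, eval_cell, eval_var, g1, g2, g3, h]
    · exact fun r => hW i j r
    · rintro s₃ ⟨a4, e4⟩
      have g2 : s₃.var 2 = i := (a4.var _ (by decide)).trans f2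
      have g3 : s₃.var 3 = j := (a4.var _ (by decide)).trans hy
      refine .store (by decide) (by decide) (by decide)
        (by rw [eval_var, e4]; exact hW i j n hn le_rfl) ?_
      simp only [eval_var, g2, g3, e4]
      refine ⟨⟨(a2.trans a4 (by decide) (by decide) (by decide)).setArr (by decide) _ _ _, ?_⟩, g3⟩
      intro u v hu hv hv' h
      simp only [State.setArr, true_and]
      split_ifs with huv
      · rw [huv.1, huv.2]
      · rw [a4.arr _ (by decide)]
        exact e2 u v hu hv hv' (by omega)
  · rintro s₂ ⟨a2, e2⟩
    exact ⟨⟨a1.trans a2 (by decide) (by decide) (by decide),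
      fun u v hu hu' hv hv' => e2 u v hu hv hv' (by omega)⟩, (a2.var _ (by decide)).trans hx⟩

/-- Program: the step `var 7` of the Faddeev-LeVerrier algorithm for the matrix in array `1`. The
matrices are stored one below the other in array `2`, the last trace is in `var 6`. -/
def faddeevStepCmd : Cmd :=
  .seq (forLoop 2 (lit 0) (var 0) (forLoop 3 (lit 0) (var 0)
    (.seq (sumCmd (var 0) (.cell 1 (var 2) (var 4) * .cell 2 (var 0 * var 7 + var 4) (var 3)))
      (.store 2 (var 0 * (var 7 + lit 1) + var 2) (var 3)
        (var 6 * .cell 1 (var 2) (var 3) - var 7 * var 5)))))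
    (.seq (sumCmd (var 0) (.cell 2 (var 0 * (var 7 + lit 1) + var 4) (var 4)))
      (.assign 6 (var 5)))

theorem halts_faddeevStepCmd {k : ℤ} {l : ℕ} {A : ℤ → ℤ → ℤ} (h0 : s.var 0 = k)
    (hk : 0 ≤ k) (hkβ : k ≤ β) (h7 : s.var 7 = l) (h6 : s.var 6 = (faddeev k A l).2)
    (hA : s.arr 1 = A) (hC : ∀ u v, 0 ≤ u → u < k → 0 ≤ v → v < k →
      s.arr 2 (k * l + u) v = (faddeev k A l).1 u v)
    (hb₁ : ∀ u v r, 0 ≤ u → u < k → 0 ≤ v → v < k → 0 ≤ r → r ≤ k →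
      |∑ j ∈ Finset.Ico 0 r, A u j * (faddeev k A l).1 j v| < 2 ^ β)
    (hb₂ : ∀ u v, 0 ≤ u → u < k → 0 ≤ v → v < k → |(faddeev k A (l + 1)).1 u v| < 2 ^ β)
    (hb₃ : ∀ r, 0 ≤ r → r ≤ k → |∑ u ∈ Finset.Ico 0 r, (faddeev k A (l + 1)).1 u u| < 2 ^ β) :
    Halts β faddeevStepCmd (sumsSteps β + (1 + (β * 3 + 2) + 1))
      (fun s' => s.Agree [2, 3, 4, 5, 6] [2] [] s' ∧ s'.var 6 = (faddeev k A (l + 1)).2 ∧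
        ∀ u v, 0 ≤ u → u < k → 0 ≤ v → v < k →
          s'.arr 2 (k * (l + 1 : ℕ) + u) v = (faddeev k A (l + 1)).1 u v) s := by
  have hmul : k * ((l : ℤ) + 1) = k * l + k := by ring
  have hloop : Halts β (forLoop 2 (lit 0) (var 0) (forLoop 3 (lit 0) (var 0)
      (.seq (sumCmd (var 0) (.cell 1 (var 2) (var 4) * .cell 2 (var 0 * var 7 + var 4) (var 3)))
      (.store 2 (var 0 * (var 7 + lit 1) + var 2) (var 3)
        (var 6 * .cell 1 (var 2) (var 3) - var 7 * var 5))))) (sumsSteps β)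
      (fun s' => s.Agree [2, 3, 4, 5] [2] [] s' ∧ ∀ u v, 0 ≤ u → u < k → 0 ≤ v → v < k →
          s'.arr 2 (k * (l + 1 : ℕ) + u) v = (faddeev k A (l + 1)).1 u v) s := by
    refine Halts.forLoop (fun i s' => s.Agree [2, 3, 4, 5] [2] [] s' ∧
        (∀ u v, u < k → s'.arr 2 (k * l + u) v = s.arr 2 (k * l + u) v) ∧
        ∀ u v, 0 ≤ u → u < i → 0 ≤ v → v < k →
          s'.arr 2 (k * (l + 1 : ℕ) + u) v = (faddeev k A (l + 1)).1 u v) hk le_rfl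
      (lt_two_pow_of_le hkβ) (by omega) (by decide) (by decide) rfl
      (fun i s' h => (h.1.var _ (by decide)).trans h0)
      (fun i s' z h => ⟨h.1.setVar (by decide) _, h.2⟩)
      ⟨.refl s, fun _ _ _ => rfl, fun u v hu hu' => by omega⟩ ?_ fun _ h => ⟨h.1, h.2.2⟩
    rintro i s₁ hi hi' ⟨a1, d1, e1⟩ hx
    refine Halts.forLoop (fun j s' => s₁.Agree [3, 4, 5] [2] [] s' ∧
        (∀ u v, u < k → s'.arr 2 (k * l + u) v = s.arr 2 (k * l + u) v) ∧
        ∀ u v, 0 ≤ u → 0 ≤ v → v < k → (u < i ∨ u = i ∧ v < j) →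
          s'.arr 2 (k * (l + 1 : ℕ) + u) v = (faddeev k A (l + 1)).1 u v) hk le_rfl
      (lt_two_pow_of_le hkβ) (by omega) (by decide) (by decide) rfl
      (fun j s' h => (h.1.var _ (by decide)).trans ((a1.var _ (by decide)).trans h0))
      (fun j s' z h => ⟨h.1.setVar (by decide) _, h.2⟩)
      ⟨.refl s₁, d1, fun u v hu hv hv' h => e1 u v hu (by omega) hv hv'⟩ ?_ ?_
    · rintro j s₂ hj hj' ⟨a2, d2, e2⟩ hy
      have a3 : s.Agree [2, 3, 4, 5] [2] [] s₂ := a1.trans a2 (by decide) (by decide) (by decide)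
      have f2 : s₂.var 2 = i := (a2.var _ (by decide)).trans hx
      refine .seq ((halts_sumCmd (by decide) (by decide) hk hkβ
        (f := fun r => A i r * (faddeev k A l).1 r j) ?_ ?_ ?_).imp ?_)
      · intro s' a
        exact (a.var _ (by decide)).trans ((a3.var _ (by decide)).trans h0)
      · intro s' r a hr hr' h
        have g0 : s'.var 0 = k := (a.var _ (by decide)).trans ((a3.var _ (by decide)).trans h0)
        have g1 : s'.arr 1 = A :=
          (a.arr _ (by decide)).trans ((a3.arr _ (by decide)).trans hA)
        have g2 : s'.var 2 = i := (a.var _ (by decide)).trans f2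
        have g3 : s'.var 3 = j := (a.var _ (by decide)).trans hy
        have g4 : s'.arr 2 = s₂.arr 2 := a.arr _ (by decide)
        have g7 : s'.var 7 = l := (a.var _ (by decide)).trans ((a3.var _ (by decide)).trans h7)
        simp only [eval_mul, eval_add, eval_cell, eval_var, g0, g1, g2, g3, g4, g7, h]
        rw [d2 r j hr', hC r j hr hr' hj hj']
      · exact fun r => hb₁ i j r hi hi' hj hj'
      · rintro s₃ ⟨a4, e4⟩
        have a5 := a3.trans a4 (X := [2, 3, 4, 5]) (by decide) (A := [2]) (by decide) (by decide)
        have g0 : s₃.var 0 = k := (a5.var _ (by decide)).trans h0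
        have g1 : s₃.arr 1 = A := (a5.arr _ (by decide)).trans hA
        have g2 : s₃.var 2 = i := (a4.var _ (by decide)).trans f2
        have g3 : s₃.var 3 = j := (a4.var _ (by decide)).trans hy
        have g6 : s₃.var 6 = (faddeev k A l).2 := (a5.var _ (by decide)).trans h6
        have g7 : s₃.var 7 = l := (a5.var _ (by decide)).trans h7
        have hev : (var 6 * .cell 1 (var 2) (var 3) - var 7 * var 5 : Expr).eval s₃ =
            (faddeev k A (l + 1)).1 i j := by
          simp only [eval_mul, eval_sub, eval_cell, eval_var, g1, g2, g3, g6, g7, e4,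
            faddeev_succ_fst]
        refine .store (by decide) (by decide) (by decide)
          (by rw [hev]; exact hb₂ i j hi hi' hj hj') ?_
        rw [hev]
        simp only [eval_mul, eval_add, eval_var, eval_lit, g0, g2, g3, g7]
        refine ⟨⟨(a2.trans a4 (by decide) (by decide) (by decide)).setArr (by decide) _ _ _,
          ?_, ?_⟩, g3⟩
        · intro u v hu
          simp only [State.setArr, true_and]
          rw [if_neg (by rw [hmul]; omega), a4.arr _ (by decide)]
          exact d2 u v hu
        · intro u v hu hv hv' h
          simp only [State.setArr, true_and]
          push_cast
          split_ifs with huv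
          · rw [huv.2, show u = i by omega]
          · rw [a4.arr _ (by decide)]
            exact_mod_cast e2 u v hu hv hv' (by omega)
    · rintro s₂ ⟨a2, d2, e2⟩
      exact ⟨⟨a1.trans a2 (by decide) (by decide) (by decide), d2,
        fun u v hu hu' hv hv' => e2 u v hu hv hv' (by omega)⟩, (a2.var _ (by decide)).trans hx⟩
  refine .seq (hloop.imp ?_)
  rintro s₁ ⟨a1, e1⟩
  refine .seq ((halts_sumCmd (by decide) (by decide) hk hkβ
    (f := fun r => (faddeev k A (l + 1)).1 r r) ?_ ?_ hb₃).imp ?_)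
  · intro s' a
    exact (a.var _ (by decide)).trans ((a1.var _ (by decide)).trans h0)
  · intro s' r a hr hr' h
    have g0 : s'.var 0 = k := (a.var _ (by decide)).trans ((a1.var _ (by decide)).trans h0)
    have g4 : s'.arr 2 = s₁.arr 2 := a.arr _ (by decide)
    have g7 : s'.var 7 = l := (a.var _ (by decide)).trans ((a1.var _ (by decide)).trans h7)
    simp only [eval_mul, eval_add, eval_cell, eval_var, eval_lit, g0, g4, g7, h]
    exact_mod_cast e1 r r hr hr' hr hr'
  · rintro s₂ ⟨a2, e2⟩
    refine .assign (by decide) (by rw [eval_var, e2]; exact hb₃ k hk le_rfl) ?_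
    rw [eval_var, e2]
    have a0 : s.Agree [2, 3, 4, 5, 6] [2] [] s := .refl s
    have a3 := (a0.trans a1 (by decide) (by decide) (by decide)).trans a2 (by decide) (by decide)
      (by decide)
    refine ⟨a3.setVar (by decide) _, rfl, ?_⟩
    intro u v hu hu' hv hv'
    rw [← e1 u v hu hu' hv hv', ← a2.arr 2 (by decide)]
    rfl

/-- Program: run the Faddeev-LeVerrier algorithm. -/
def faddeevCmd : Cmd := .seq (.assign 6 (lit 1)) (forLoop 7 (lit 0) (var 0) faddeevStepCmd)

/-- A bound for the number of steps of `faddeevCmd`. -/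
def faddeevSteps (β : ℕ) : ℕ := 1 + (β * (sumsSteps β + (1 + (β * 3 + 2) + 1) + 2) + 2)

theorem halts_faddeevCmd {k a : ℤ} {A : ℤ → ℤ → ℤ} (h0 : s.var 0 = k)
    (hk : 0 ≤ k) (hkβ : k ≤ β) (hA : s.arr 1 = A) (hC : s.arr 2 = 0) (ha : 1 ≤ a)
    (hAa : ∀ u v, 0 ≤ u → u < k → 0 ≤ v → v < k → |A u v| ≤ a)
    (hβ : k * (a * (a * (k * k * a) ^ k.toNat)) < 2 ^ β) (hβ0 : β ≠ 0) :
    Halts β faddeevCmd (faddeevSteps β) (fun s' => s.Agree [2, 3, 4, 5, 6, 7] [2] [] s' ∧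
      s'.var 6 = (faddeev k A k.toNat).2) s := by
  refine .seq (.assign (by decide) ?_ ?_)
  · rw [eval_lit, abs_one]
    exact one_lt_pow₀ (by norm_num) hβ0
  refine Halts.forLoop (fun l s' => s.Agree [2, 3, 4, 5, 6, 7] [2] [] s' ∧
      s'.var 6 = (faddeev k A l.toNat).2 ∧ ∀ u v, 0 ≤ u → u < k → 0 ≤ v → v < k →
        s'.arr 2 (k * l.toNat + u) v = (faddeev k A l.toNat).1 u v) hk le_rfl
    (lt_two_pow_of_le hkβ) (by omega) (by decide) (by decide) rfl
    (fun l s' h => (h.1.var _ (by decide)).trans h0)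
    (fun l s' z h => ⟨h.1.setVar (by decide) _, h.2⟩) ?_ ?_ fun _ h => ⟨h.1, h.2.1⟩
  · refine ⟨(State.Agree.refl s).setVar (by decide) _, rfl, fun u v _ _ _ _ => ?_⟩
    change s.arr 2 _ _ = _
    rw [hC]
    rfl
  · rintro l' s₁ hl hl' ⟨a1, e1, c1⟩ hx
    lift l' to ℕ using hl with l
    have hk1 : 1 ≤ k := by omega
    have hpow : ∀ l : ℕ, (l : ℤ) < k → a * (k * k * a) ^ l ≤ a * (k * k * a) ^ k.toNat := by
      intro l hl
      refine mul_le_mul_of_nonneg_left (pow_le_pow_right₀ ?_ (by omega)) (by omega)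
      have : 1 ≤ k * k := by nlinarith
      nlinarith
    set h := a * (k * k * a) ^ k.toNat with hh
    have hh0 : 0 ≤ h := by positivity
    have hF : ∀ l : ℕ, (l : ℤ) ≤ k → ∀ u v, 0 ≤ u → u < k → 0 ≤ v → v < k →
        |(faddeev k A l).1 u v| ≤ h := by
      intro l hl u v hu hu' hv hv'
      cases l with
      | zero => simpa [faddeev] using hh0
      | succ l =>
        have := (faddeev_bound hk (by omega) hAa l (by push_cast at hl; omega)).1 u v hu hu' hv hv'
        exact this.trans (hpow l (by push_cast at hl; omega))
    have hah : h ≤ a * h := by nlinarith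
    have hkah : a * h ≤ k * (a * h) := by nlinarith
    rw [Int.toNat_natCast] at e1 c1
    refine (halts_faddeevStepCmd ((a1.var _ (by decide)).trans h0) hk hkβ hx e1
      ((a1.arr _ (by decide)).trans hA) c1 ?_ ?_ ?_).imp ?_
    · intro u v r hu hu' hv hv' hr hr'
      refine lt_of_le_of_lt (abs_sum_Ico_int_le (b := a * h) hr fun j hj hj' => ?_)
        (lt_of_le_of_lt ?_ hβ)
      · rw [abs_mul]
        exact mul_le_mul (hAa u j hu hu' hj (by omega)) (hF l hl'.le j v hj (by omega) hv hv')
          (abs_nonneg _) (by omega)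
      · exact mul_le_mul_of_nonneg_right hr' (by positivity)
    · intro u v hu hu' hv hv'
      have := hF (l + 1) (by push_cast; omega) u v hu hu' hv hv'
      omega
    · intro r hr hr'
      refine lt_of_le_of_lt (abs_sum_Ico_int_le (b := h) hr fun j hj hj' =>
        hF (l + 1) (by push_cast; omega) j j hj (by omega) hj (by omega)) ?_
      have := mul_le_mul_of_nonneg_right hr' hh0
      nlinarith
    · rintro s₂ ⟨a2, e2, c2⟩
      have ht : ((l : ℤ) + 1).toNat = l + 1 := by omega
      rw [ht]
      exact ⟨⟨a1.trans a2 (by decide) (by decide) (by decide), e2, c2⟩,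
        (a2.var _ (by decide)).trans hx⟩

end GroupRAM

open Finset in
theorem exists_prod_zpow_of_closure_eq_top {G : Type*} [CommGroup G] {ι : Type*} [Fintype ι]
    {a : ι → G} (h : Subgroup.closure (Set.range a) = ⊤) (g : G) :
    ∃ x : ι → ℤ, ∏ i, a i ^ x i = g := by
  classical
  have hg : g ∈ Subgroup.closure (Set.range a) := h ▸ Subgroup.mem_top g
  induction hg using Subgroup.closure_induction with
  | mem g hg =>
    obtain ⟨i, rfl⟩ := hg
    refine ⟨Pi.single i 1, ?_⟩
    rw [prod_eq_single i (fun j _ hj => by simp [hj]) (by simp)]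
    simp
  | one => exact ⟨0, by simp⟩
  | mul g g' _ _ hg hg' =>
    obtain ⟨x, rfl⟩ := hg
    obtain ⟨y, rfl⟩ := hg'
    exact ⟨x + y, by simp [zpow_add, prod_mul_distrib]⟩
  | inv g _ hg =>
    obtain ⟨x, rfl⟩ := hg
    exact ⟨-x, by simp⟩

theorem abs_lt_two_pow_matrixSize {k n : ℕ} (M : Matrix (Fin k) (Fin n) ℤ) (i : Fin k)
    (j : Fin n) : |M i j| < 2 ^ matrixSize M := by
  rw [← bitSize_le_iff, matrixSize]
  have h1 : 1 + bitSize (M i j) ≤ ∑ j, (1 + bitSize (M i j)) :=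
    Finset.single_le_sum (f := fun j => 1 + bitSize (M i j)) (fun _ _ => Nat.zero_le _)
      (Finset.mem_univ j)
  have h2 : ∑ j, (1 + bitSize (M i j)) ≤ ∑ i, ∑ j, (1 + bitSize (M i j)) :=
    Finset.single_le_sum (f := fun i => ∑ j, (1 + bitSize (M i j))) (fun _ _ => Nat.zero_le _)
      (Finset.mem_univ i)
  omega

/-- Extend a vector by zeros. -/
def extendZero {k : ℕ} (x : Fin k → ℤ) (r : ℤ) : ℤ :=
  if h : 0 ≤ r ∧ r < k then x ⟨r.toNat, by omega⟩ else 0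

theorem extendZero_coe {k : ℕ} (x : Fin k → ℤ) (i : Fin k) : extendZero x (i : ℕ) = x i := by
  simp [extendZero]

namespace GroupRAM

section Input

variable {G : Type*} [CommGroup G] {k n : ℕ} (M : Matrix (Fin k) (Fin n) ℤ) (a : Fin k → G)

theorem inputState_arr_coe (i : Fin k) (j : Fin n) :
    (inputState M a).arr 0 (i : ℕ) (j : ℕ) = M i j := by simp [inputState]

theorem inputState_grp_coe (i : Fin k) : (inputState M a).grp 0 (i : ℕ) = a i := by
  simp [inputState]

theorem inputState_supported : Supported k n ((inputState M a).arr 0) := by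
  intro i j h
  by_contra h'
  exact h (dif_neg (by tauto))

theorem abs_inputState_arr_lt (A : ℕ) (i j : ℤ) :
    |(inputState M a).arr A i j| < 2 ^ matrixSize M := by
  simp only [inputState]
  split_ifs
  · exact abs_lt_two_pow_matrixSize M _ _
  · simp

theorem sum_inputState_arr {N : ℤ} (hN : n ≤ N) (i : ℤ) (y : ℤ → ℤ) :
    ∑ j ∈ Finset.Ico 0 N, (inputState M a).arr 0 i j * y j =
      ∑ j : Fin n, (inputState M a).arr 0 i (j : ℕ) * y (j : ℕ) := by
  rw [← sum_Ico_int_eq_sum_fin n fun j => (inputState M a).arr 0 i j * y j]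
  refine (Finset.sum_subset (Finset.Ico_subset_Ico_right hN) fun j _ hj => ?_).symm
  have : (inputState M a).arr 0 i j = 0 := by
    by_contra h
    exact hj (Finset.mem_Ico.2 (inputState_supported M a i j h).2)
  rw [this, zero_mul]

variable {M a}

theorem presents_inputState {D : ℤ} (ha : Subgroup.closure (Set.range a) = ⊤)
    (hM : ∀ x : Fin k → ℤ, ∏ i, a i ^ x i = 1 ↔ x ∈ intcol M)
    (hD : ∀ z : Fin k → ℤ, D • z ∈ intcol M) :
    Presents k (n + k : ℕ) D ((inputState M a).arr 0) ((inputState M a).grp 0) := by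
  have hprod : ∀ x : ℤ → ℤ, ∏ i ∈ Finset.Ico 0 (k : ℤ), (inputState M a).grp 0 i ^ x i =
      ∏ i : Fin k, a i ^ x (i : ℕ) := fun x => by
    rw [prod_Ico_int_eq_prod_fin]
    simp only [inputState_grp_coe]
  have hmul : ∀ (i : Fin k) (y : ℤ → ℤ), ∑ j ∈ Finset.Ico 0 ((n + k : ℕ) : ℤ),
      (inputState M a).arr 0 (i : ℕ) j * y j = M.mulVec (fun j => y (j : ℕ)) i := fun i y => by
    rw [sum_inputState_arr M a (by push_cast; omega)]
    simp only [inputState_arr_coe]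
    rfl
  refine ⟨fun h => ?_, fun x => ?_⟩
  · obtain ⟨x, hx⟩ := exists_prod_zpow_of_closure_eq_top ha h
    exact ⟨extendZero x, by rw [hprod]; simpa only [extendZero_coe] using hx⟩
  · rw [hprod, hM fun i => x (i : ℕ)]
    constructor
    · intro hx
      obtain ⟨y, hy⟩ := mem_intcol_iff.1 hx
      refine ⟨extendZero y, 0, fun i hi => ?_⟩
      rw [Finset.mem_Ico] at hi
      lift i to ℕ using hi.1
      have := hmul ⟨i, by omega⟩ (extendZero y)
      simp only [extendZero_coe] at this
      rw [this, hy]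
      simp
    · rintro ⟨y, z, hyz⟩
      have : (fun i : Fin k => x (i : ℕ)) =
          M.mulVec (fun j => y (j : ℕ)) + D • fun i : Fin k => z (i : ℕ) := by
        funext i
        rw [hyz _ (Finset.mem_Ico.2 ⟨by omega, by omega⟩), hmul]
        rfl
      rw [this]
      exact add_mem (mem_intcol_iff.2 ⟨_, rfl⟩) (hD _)

end Input

theorem _root_.Presents.isInternal {G : Type*} [CommGroup G] {k : ℕ} {n D : ℤ} {W : ℤ → ℤ → ℤ}
    {g : ℤ → G} (h : Presents k n D W g) (hkn : k ≤ n) (hW : DiagUpTo k W) :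
    DirectSum.IsInternal
      (fun i : Fin k => AddSubgroup.zmultiples (Additive.ofMul (g (i : ℕ)))) := by
  refine isInternal_zmultiples (fun i : Fin k => g (i : ℕ)) (fun y => ?_) fun x hx i => ?_
  · obtain ⟨x, hx⟩ := h.gen y
    exact ⟨fun i => x (i : ℕ), by rw [← hx, prod_Ico_int_eq_prod_fin]⟩
  · have h1 : ∏ i ∈ Finset.Ico 0 (k : ℤ), g i ^ extendZero x i = 1 := by
      rw [prod_Ico_int_eq_prod_fin]
      simpa only [extendZero_coe] using hx
    have := h.zpow_eq_one_of_diag hkn hW h1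
      (Finset.mem_Ico.2 ⟨by omega, by omega⟩ : ((i : ℕ) : ℤ) ∈ _)
    simpa only [extendZero_coe] using this

open GroupRAM.Expr

/-- Program: decompose the group. -/
def decomposeCmd : Cmd :=
  .seq gramCmd (.seq faddeevCmd (.seq (.assign 9 (var 6 * var 6))
    (.seq (.assign 1 (var 1 + var 0)) diagonalizeCmd)))

/-- A bound for the number of steps of `decomposeCmd`. -/
def decomposeSteps (β : ℕ) : ℕ :=
  sumsSteps β + (faddeevSteps β + (1 + (1 + (β * (phaseSteps β + 2) + 2))))

/-- A bound for the number of digits of all integers in a run of `decomposeCmd`, in terms of the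
size of the matrix. -/
def digitBound (m : ℕ) : ℕ := 10 * m ^ 2 + 14 * m + 4

theorem digitBound_spec {k m : ℕ} (hk : k ≤ m) {a : ℤ} (ha : a = 2 ^ (3 * m)) :
    2 * (k * (a * (a * (k * k * a) ^ k)) + 1) ^ 2 < 2 ^ digitBound m := by
  have hk' : (k : ℤ) ≤ 2 ^ m := by exact_mod_cast hk.trans Nat.lt_two_pow_self.le
  have h0 : (0 : ℤ) ≤ k := by positivity
  have h1 : (k * k * a : ℤ) ≤ 2 ^ (5 * m) := by
    rw [ha, show 5 * m = m + m + 3 * m by ring, pow_add, pow_add]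
    gcongr
  have h2 : (k * k * a : ℤ) ^ k ≤ 2 ^ (5 * m ^ 2) := by
    calc (k * k * a : ℤ) ^ k ≤ (2 ^ (5 * m)) ^ k :=
          pow_le_pow_left₀ (by rw [ha]; positivity) h1 k
      _ ≤ (2 ^ (5 * m)) ^ m := pow_le_pow_right₀ (one_le_pow₀ (by norm_num)) hk
      _ = 2 ^ (5 * m ^ 2) := by rw [← pow_mul]; ring_nf
  have h3 : (k * (a * (a * (k * k * a) ^ k)) : ℤ) ≤ 2 ^ (5 * m ^ 2 + 7 * m) := by
    rw [show 5 * m ^ 2 + 7 * m = m + (3 * m + (3 * m + 5 * m ^ 2)) by ring, pow_add 2 m,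
      pow_add 2 (3 * m), pow_add 2 (3 * m), ← ha]
    have : 0 ≤ a := by rw [ha]; positivity
    gcongr
  have h4 : (1 : ℤ) ≤ 2 ^ (5 * m ^ 2 + 7 * m) := one_le_pow₀ (by norm_num)
  have h5 : (k * (a * (a * (k * k * a) ^ k)) + 1 : ℤ) ≤ 2 ^ (5 * m ^ 2 + 7 * m + 1) := by
    rw [pow_succ]; linarith
  have h6 : (0 : ℤ) ≤ k * (a * (a * (k * k * a) ^ k)) + 1 := by
    have : 0 ≤ a := by rw [ha]; positivity
    positivity
  calc _ ≤ 2 * (2 ^ (5 * m ^ 2 + 7 * m + 1)) ^ 2 := by gcongr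
    _ = (2 : ℤ) ^ (10 * m ^ 2 + 14 * m + 3) := by rw [← pow_mul, ← pow_succ']; ring_nf
    _ < 2 ^ digitBound m := pow_lt_pow_right₀ (by norm_num) (by rw [digitBound]; omega)

theorem halts_decomposeCmd {G : Type*} [CommGroup G] [Finite G] {k n : ℕ} {a : Fin k → G}
    {M : Matrix (Fin k) (Fin n) ℤ} (ha : Subgroup.closure (Set.range a) = ⊤)
    (hM : ∀ x : Fin k → ℤ, ∏ i, a i ^ x i = 1 ↔ x ∈ intcol M) {β : ℕ}
    (hβ : β = digitBound (matrixSize M)) :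
    Halts β decomposeCmd (decomposeSteps β) (fun s : State G => s.var 0 = k ∧
      DirectSum.IsInternal
        (fun i : Fin k => AddSubgroup.zmultiples (Additive.ofMul (s.grp 0 (i : ℕ)))))
      (inputState M a) := by
  set m := matrixSize M with hm
  have hknm : k + n ≤ m := by rw [hm, matrixSize]; omega
  have hmβ : m ≤ β := by rw [hβ, digitBound]; nlinarith
  set b : ℤ := 2 ^ (3 * m) with hb
  have hspec := digitBound_spec (k := k) (m := m) (by omega) hb
  rw [← hβ] at hspec
  have hb1 : 1 ≤ b := one_le_pow₀ (by norm_num)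
  have hgram : ∀ u v r : ℤ, 0 ≤ r → r ≤ n →
      |∑ j ∈ Finset.Ico 0 r, (inputState M a).arr 0 u j * (inputState M a).arr 0 v j| ≤ b := by
    intro u v r hr hr'
    refine (abs_sum_Ico_int_le (b := 2 ^ m * 2 ^ m) hr fun j _ _ => ?_).trans ?_
    · rw [abs_mul]
      exact mul_le_mul (abs_inputState_arr_lt M a _ _ _).le (abs_inputState_arr_lt M a _ _ _).le
        (abs_nonneg _) (by positivity)
    · rw [hb, show 3 * m = m + (m + m) by ring, pow_add 2 m, pow_add 2 m]
      have : r ≤ 2 ^ m := (lt_two_pow_of_le (by omega : r ≤ m)).le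
      gcongr
  have hb2 : b < 2 ^ β := by
    refine pow_lt_pow_right₀ (by norm_num) ?_
    rw [hβ, digitBound]
    nlinarith
  set X := (k : ℤ) * (b * (b * (k * k * b) ^ k)) with hX
  have hX0 : 0 ≤ X := by positivity
  have hXβ : X < 2 ^ β := by nlinarith
  refine .seq ((halts_gramCmd (k := k) (n := n) rfl rfl (by omega) (by omega) (by omega) (by omega)
    fun u v r hr hr' => (hgram u v r hr hr').trans_lt hb2).imp ?_)
  rintro s₁ ⟨a1, e1⟩
  have hgramM : ∀ i j : Fin k, s₁.arr 1 (i : ℕ) (j : ℕ) = (M * M.transpose) i j := by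
    intro i j
    rw [e1 _ _ (by omega) (by omega) (by omega) (by omega), sum_inputState_arr M a le_rfl]
    simp only [inputState_arr_coe]
    rfl
  set c := (faddeev k (s₁.arr 1) k).2 with hc
  have hdet : c = k.factorial * (M * M.transpose).det := by
    rw [hc, faddeev_eq_factorial_mul_det]
    · congr 2
      ext i j
      exact hgramM i j
    · intro i j
      rw [hgramM, hgramM, ← Matrix.transpose_apply (M * M.transpose), Matrix.transpose_mul,
        Matrix.transpose_transpose]
  have hc0 : c ≠ 0 := by
    rw [hdet]
    refine mul_ne_zero (by exact_mod_cast Nat.factorial_ne_zero k) ?_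
    refine det_mul_transpose_ne_zero M (N := Nat.card G) (by exact_mod_cast Nat.card_pos.ne')
      fun i => (hM _).1 ?_
    refine Finset.prod_eq_one fun j _ => ?_
    rcases eq_or_ne j i with rfl | hj
    · simp
    · simp [hj]
  have hAb : ∀ u v : ℤ, 0 ≤ u → u < k → 0 ≤ v → v < k → |s₁.arr 1 u v| ≤ b := by
    intro u v hu hu' hv hv'
    rw [e1 u v hu hu' hv hv']
    exact hgram u v n (by omega) le_rfl
  have hcX : |c| ≤ X + 1 := by
    rcases Nat.eq_zero_or_pos k with hk | hk
    · subst hk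
      simpa [hc, faddeev] using hX0
    · obtain ⟨l, hl⟩ := Nat.exists_eq_succ_of_ne_zero hk.ne'
      have h1 := (faddeev_bound (k := k) (by omega) (by omega) hAb l (by omega)).2
      rw [← Nat.succ_eq_add_one, ← hl, ← hc] at h1
      have hk1 : (1 : ℤ) ≤ k := by exact_mod_cast hk
      have h2 : (k * k * b : ℤ) ^ l ≤ (k * k * b) ^ k := by
        refine pow_le_pow_right₀ ?_ (by omega)
        have : (1 : ℤ) ≤ k * k := by nlinarith
        nlinarith
      have h3 : b * (k * k * b : ℤ) ^ l ≤ b * (b * (k * k * b) ^ k) := by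
        refine mul_le_mul_of_nonneg_left (h2.trans ?_) (by omega)
        exact le_mul_of_one_le_left (by positivity) hb1
      have h4 := mul_le_mul_of_nonneg_left h3 (by omega : (0 : ℤ) ≤ k)
      omega
  have hcc : c * c ≤ (X + 1) ^ 2 := by
    rw [← abs_mul_abs_self c, sq]
    exact mul_le_mul hcX hcX (abs_nonneg _) (by omega)
  have hcc0 : 0 < c * c := mul_self_pos.2 hc0
  refine .seq ((halts_faddeevCmd (k := k) (a := b) (A := s₁.arr 1)
    (a1.var _ (by decide)) (by omega) (by omega) rfl ((a1.arr _ (by decide)).trans ?_) hb1 hAb hXβ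
    (by rw [hβ, digitBound]; omega)).imp ?_)
  · funext i j
    simp [inputState]
  rintro s₂ ⟨a2, e2⟩
  rw [Int.toNat_natCast, ← hc] at e2
  have a0 : (inputState M a).Agree [1, 2, 3, 4, 5, 6, 7, 9] [1, 2] [] (inputState M a) := .refl _
  have a3 := (a0.trans a1 (by decide) (by decide) (by decide)).trans a2 (by decide) (by decide)
    (by decide)
  have hev : (var 6 * var 6).eval s₂ = c * c := by rw [eval_mul, eval_var, e2]
  refine .seq (.assign (by decide) (by rw [hev, abs_of_pos hcc0]; linarith) ?_)
  rw [hev]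
  set s₃ := s₂.setVar 9 (c * c) with hs₃
  have a4 : (inputState M a).Agree [1, 2, 3, 4, 5, 6, 7, 9] [1, 2] [] s₃ :=
    a3.setVar (by decide) _
  have hev₁ : (var 1 + var 0).eval s₃ = (n + k : ℕ) := by
    have h0 : s₃.var 0 = k := a4.var _ (by decide)
    have h1 : s₃.var 1 = n := (a2.var 1 (by decide)).trans (a1.var 1 (by decide))
    rw [eval_add, eval_var, eval_var, h0, h1]
    push_cast
    rfl
  refine .seq (.assign (by decide) ?_ ?_)
  · rw [hev₁, abs_of_nonneg (by omega)]
    exact lt_two_pow_of_le (by omega)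
  rw [hev₁]
  have a5 := a4.setVar (by decide : 1 ∈ _) ((n + k : ℕ) : ℤ)
  have hred : Reducing k (n + k : ℕ) (c * c) 0 (s₃.setVar 1 ((n + k : ℕ) : ℤ)) := by
    refine ⟨a5.var _ (by decide), rfl, rfl, ?_, ?_, ?_⟩
    · rw [a5.arr _ (by decide)]
      intro i j hij
      have := inputState_supported M a i j hij
      push_cast
      omega
    · rw [a5.arr _ (by decide)]
      intro i j hij hlt
      by_contra h
      have := inputState_supported M a i j h
      omega
    · rw [a5.arr _ (by decide), a5.grp _ (by decide)]
      refine presents_inputState ha hM fun z => ?_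
      have h1 : (c * c) • z = (M * M.transpose).det • ((c * k.factorial) • z) := by
        rw [smul_smul]
        congr 1
        conv_lhs => rw [hdet]
        rw [hdet]
        ring
      rw [h1]
      exact det_smul_mem_intcol M _
  refine (hred.diagonalizeCmd (by omega) (by push_cast; omega) (by omega) hcc0
    (by linarith)).imp ?_
  intro s₄ h4
  exact ⟨h4.var0, h4.pres.isInternal (by push_cast; omega) h4.diag⟩

/-- A function on the natural numbers given by a polynomial. -/
def IsPoly (f : ℕ → ℕ) : Prop := ∃ p : Polynomial ℕ, ∀ m, p.eval m = f m

namespace IsPoly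

theorem const (c : ℕ) : IsPoly fun _ => c := ⟨Polynomial.C c, by simp⟩

theorem id : IsPoly fun m => m := ⟨Polynomial.X, by simp⟩

theorem add {f g : ℕ → ℕ} (hf : IsPoly f) (hg : IsPoly g) : IsPoly fun m => f m + g m := by
  obtain ⟨p, hp⟩ := hf
  obtain ⟨q, hq⟩ := hg
  exact ⟨p + q, by simp [hp, hq]⟩

theorem mul {f g : ℕ → ℕ} (hf : IsPoly f) (hg : IsPoly g) : IsPoly fun m => f m * g m := by
  obtain ⟨p, hp⟩ := hf
  obtain ⟨q, hq⟩ := hg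
  exact ⟨p * q, by simp [hp, hq]⟩

theorem pow {f : ℕ → ℕ} (hf : IsPoly f) (e : ℕ) : IsPoly fun m => f m ^ e := by
  obtain ⟨p, hp⟩ := hf
  exact ⟨p ^ e, by simp [hp]⟩

theorem comp {f g : ℕ → ℕ} (hf : IsPoly f) (hg : IsPoly g) : IsPoly fun m => f (g m) := by
  obtain ⟨p, hp⟩ := hf
  obtain ⟨q, hq⟩ := hg
  exact ⟨p.comp q, by simp [hp, hq]⟩

end IsPoly

theorem isPoly_decomposeSteps_mul_stepCost :
    IsPoly fun β => decomposeSteps β * stepCost β := by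
  unfold decomposeSteps stepCost sumsSteps faddeevSteps phaseSteps sumsSteps
  repeat' first
    | with_reducible exact IsPoly.id
    | with_reducible exact IsPoly.const _
    | with_reducible apply IsPoly.add
    | with_reducible apply IsPoly.mul
    | with_reducible apply IsPoly.pow

theorem isPoly_digitBound : IsPoly digitBound := by
  unfold digitBound
  repeat' first
    | with_reducible exact IsPoly.id
    | with_reducible exact IsPoly.const _
    | with_reducible apply IsPoly.add
    | with_reducible apply IsPoly.mul
    | with_reducible apply IsPoly.pow

theorem inputState_bounded {G : Type*} [CommGroup G] {k n : ℕ} (M : Matrix (Fin k) (Fin n) ℤ)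
    (a : Fin k → G) : (inputState M a).Bounded (digitBound (matrixSize M)) := by
  have h : matrixSize M ≤ digitBound (matrixSize M) := by rw [digitBound]; nlinarith
  have hkn : k + n ≤ matrixSize M := by rw [matrixSize]; omega
  refine ⟨fun x => ?_, fun A i j => (abs_inputState_arr_lt M a A i j).trans_le
    (pow_le_pow_right₀ (by norm_num) h)⟩
  simp only [inputState]
  split_ifs
  · rw [abs_of_nonneg (by omega)]
    exact lt_two_pow_of_le (by omega)
  · rw [abs_of_nonneg (by omega)]
    exact lt_two_pow_of_le (by omega)
  · simp

end GroupRAM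

theorem theorem7 :
    ∃ (P : GroupRAM.Cmd) (p : Polynomial ℕ),
      ∀ (G : Type*) [CommGroup G] [Finite G] (k n : ℕ) (a : Fin k → G)
        (M : Matrix (Fin k) (Fin n) ℤ),
        Subgroup.closure (Set.range a) = ⊤ →
        (∀ x : Fin k → ℤ, ∏ i, a i ^ x i = 1 ↔ x ∈ intcol M) →
        ∃ (s : GroupRAM.State G) (t l : ℕ) (g : Fin l → G),
          GroupRAM.Runs P (GroupRAM.inputState M a) s t ∧
          t ≤ p.eval (matrixSize M) ∧
          s.Outputs g ∧
          l ≤ k ∧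
          DirectSum.IsInternal
            (fun i : Fin l => AddSubgroup.zmultiples (Additive.ofMul (g i))) := by
  obtain ⟨p, hp⟩ := GroupRAM.isPoly_decomposeSteps_mul_stepCost.comp GroupRAM.isPoly_digitBound
  refine ⟨GroupRAM.decomposeCmd, p, fun G _ _ k n a M ha hM => ?_⟩
  obtain ⟨s, t, h1, h2, -, h3, h4⟩ :=
    GroupRAM.halts_decomposeCmd ha hM rfl (GroupRAM.inputState_bounded M a)
  exact ⟨s, t, k, fun i => s.grp 0 (i : ℕ), h1, by rw [hp]; exact h2,
    ⟨h3, fun _ => rfl⟩, le_rfl, h4⟩
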